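/- Let $k\ge 1$, $d\ge 2$, and let $\Omega^+=\{1,\dots,k\}^{\mathbb N}$ with the product $\sigma$-algebra and the shift $(\sigma\omega)_i=\omega_{i+1}$. Let $\mathbb P$ be a shift-invariant probability measure on $\Omega^+$ that has the Markov property and gives positive mass to every non-empty cylinder set (a stationary Markovian full shift), and put $$p(\omega,\omega')=\mathbb P(\omega_0=i\mid\omega_1=j)\qquad\text{with } i=\omega'_0,\ j=\omega_0 .$$ Let $\mathfrak M:\Omega^+\to GL(d,\mathbb R)$ depend only on the coordinate $\omega_0$. Let $\mathcal S$ be the set of all finite products (including the identity) of matrices in $\{\mathfrak M(\omega):\omega\in\Omega^+\}$, and assume that * (strong irreducibility) there is no finite non-empty family $V_1,\dots,V_m$ of linear subspaces of $\mathbb R^d$, each different from $\{0\}$ and $\mathbb R^d$, with $A(V_1\cup\dots\cup V_m)=V_1\cup\dots\cup V_m$ for every $A\in\mathcal S$; * (contraction) there is a sequence $(A_n)$ in $\mathcal S$ such that $A_n/\|A_n\|$ converges to a matrix of rank one. Let $\mathcal X=\mathbb RP^{d-1}$, whose points are represented by unit vectors, with the metric $d_{\mathcal X}(x,y)=(1-\langle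 x,y\rangle^2)^{1/2}$ and the action $A\cdot[x]=[Ax]$ of $GL(d,\mathbb R)$. For $0<\theta<1$ let $d_\theta(\omega,\tilde\omega)=\theta^N$, where $N$ is the largest integer with $\omega_i=\tilde\omega_i$ for $0\le i<N$ (and $d_\theta(\omega,\omega)=0$). For $\alpha>0$ let $G_{\theta,\alpha}$ be the space of functions $f:\Omega^+\times\mathcal X\to\mathbb C$ that are Lipschitz in $\omega$ with respect to $d_\theta$, uniformly in $x$, and $\alpha$-Hölder in $x$ with respect to $d_{\mathcal X}$, uniformly in $\omega$. Put $|f|_\infty=\sup|f|$ and $$|f|_{\theta,\alpha}=\sup_{\omega\neq\tilde\omega\text{ or }x\neq y}\frac{|f(\omega,x)-f(\tilde\omega,y)|}{d_{\mathcal X}^\alpha(x,y)+d_\theta(\omega,\tilde\omega)} .$$ For $t\in\mathbb C$ let $$(\mathcal L_t w)(\omega,x)=\sum_{\sigma\omega'=\omega}p(\omega,\omega')\,e^{t\log\|\mathfrak M(\omega')x\|}\,w(\omega',\mathfrak M(\omega')\cdot x).$$ Then there is $\alpha_0>0$ such that for every $\alpha\in(0,\alpha_0]$ and every purely imaginary $t$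 there is $\theta_0\in(0,1]$ such that for every $\theta\in(0,\theta_0)$ there are constants $C>0$ and $\delta\in(0,1)$ such that, for all sufficiently large $n$ and all $w\in G_{\theta,\alpha}$, one has $\mathcal L_t^n w\in G_{\theta,\alpha}$ and $$|\mathcal L_t^{n}w|_{\theta,\alpha}\le C|w|_\infty+\delta^{n}|w|_{\theta,\alpha}.$$ -/

import Mathlib

open MeasureTheory ProbabilityTheory Filter Topology

noncomputable section

namespace MarkovMatrixProduct

/-! ### The one-sided shift over `k` symbols -/

/-- The one-sided sequence space `Ω⁺ = {1, …, k}^ℕ`, with its product sigma-algebra. -/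
abbrev Seq (k : ℕ) : Type := ℕ → Fin k

/-- The shift `(σ ω)ᵢ = ωᵢ₊₁`. -/
def shift {k : ℕ} (ω : Seq k) : Seq k := fun n => ω (n + 1)

/-- The sequence `i ω`, i.e. `(i ω)₀ = i` and `σ (i ω) = ω`. -/
def cons {k : ℕ} (i : Fin k) (ω : Seq k) : Seq k
  | 0 => i
  | n + 1 => ω n

/-- The preimages of `ω` under the shift are exactly the sequences `i ω`. -/
theorem shift_eq_iff {k : ℕ} (ω ω' : Seq k) : shift ω' = ω ↔ ∃ i, ω' = cons i ω := by
  constructor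
  · rintro rfl
    refine ⟨ω' 0, ?_⟩
    funext n
    cases n <;> rfl
  · rintro ⟨i, rfl⟩
    rfl

/-- `μ` is the measure of a (stationary) Markovian full shift over `k` symbols: it is
shift-invariant, it has the Markov property, and it charges every non-empty cylinder set. -/
structure IsMarkovFullShift {k : ℕ} (μ : Measure (Seq k)) : Prop where
  invariant : MeasurePreserving shift μ μ
  markov : ∀ (n : ℕ) (a : Seq k) (j : Fin k),
    μ[|{ω | ∀ i ≤ n, ω i = a i}] {ω | ω (n + 1) = j} = μ[|{ω | ω n = a n}] {ω | ω (n + 1) = j}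
  full : ∀ (s : Finset ℕ) (a : Seq k), 0 < μ {ω | ∀ i ∈ s, ω i = a i}

/-- `P i j = ℙ(ω₀ = i ∣ ω₁ = j)`. -/
def transProb {k : ℕ} (μ : Measure (Seq k)) (i j : Fin k) : ℝ :=
  (μ[|{ω | ω 1 = j}]).real {ω | ω 0 = i}

/-- `p(ω, ω')`, the conditional probability of `ω'` given that `σ ω'` is `ω`; for a Markovian `μ`
it only depends on `ω'₀` and `ω₀`. -/
def condProb {k : ℕ} (μ : Measure (Seq k)) (ω ω' : Seq k) : ℝ :=
  transProb μ (ω' 0) (ω 0)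

/-- The metric `d_θ(ω, ω') = θ ^ N`, where `N` is the first index at which `ω` and `ω'` differ
(and `0` if there is none). -/
def dSeq {k : ℕ} (θ : ℝ) (ω ω' : Seq k) : ℝ :=
  open Classical in if ω = ω' then 0 else θ ^ PiNat.firstDiff ω ω'

/-! ### Projective space -/

/-- Euclidean `d`-space. -/
abbrev Euc (d : ℕ) : Type := EuclideanSpace ℝ (Fin d)

/-- The real projective space of lines in Euclidean `d`-space. -/
abbrev Proj (d : ℕ) : Type := Projectivization ℝ (Euc d)

/-- The action of a matrix on Euclidean `d`-space. -/
def lin {d : ℕ} (A : GL (Fin d) ℝ) : Euc d →ₗ[ℝ] Euc d :=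
  Matrix.toEuclideanLin (A : Matrix (Fin d) (Fin d) ℝ)

theorem lin_injective {d : ℕ} (A : GL (Fin d) ℝ) : Function.Injective (lin A) := by
  intro v w h
  have h' : (A : Matrix (Fin d) (Fin d) ℝ).mulVec v.ofLp
      = (A : Matrix (Fin d) (Fin d) ℝ).mulVec w.ofLp := by
    simpa [lin, Matrix.toLpLin_apply] using h
  have hA : IsUnit (A : Matrix (Fin d) (Fin d) ℝ) := A.isUnit
  exact WithLp.ofLp_injective 2 (Matrix.mulVec_injective_of_isUnit hA h')

/-- The projective action `A · [v] = [A v]`. -/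
def act {d : ℕ} (A : GL (Fin d) ℝ) (x : Proj d) : Proj d :=
  Projectivization.map (lin A) (lin_injective A) x

/-- `‖A x‖` for a unit vector `x` representing the given point of projective space, written as
`‖A v‖ / ‖v‖` for an arbitrary representative `v`. -/
def stretch {d : ℕ} (A : GL (Fin d) ℝ) (x : Proj d) : ℝ := ‖lin A x.rep‖ / ‖x.rep‖

/-- The metric `(1 - ⟨x, y⟩²)^{1/2}` on projective space, `x` and `y` being unit vectors,
written for arbitrary representatives. -/
def dProj {d : ℕ} (x y : Proj d) : ℝ :=
  Real.sqrt (1 - (inner ℝ x.rep y.rep / (‖x.rep‖ * ‖y.rep‖)) ^ 2)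

theorem stretch_mk {d : ℕ} (A : GL (Fin d) ℝ) (v : Euc d) (hv : v ≠ 0) :
    stretch A (Projectivization.mk ℝ v hv) = ‖lin A v‖ / ‖v‖ := by
  obtain ⟨a, ha⟩ := Projectivization.exists_smul_eq_mk_rep ℝ v hv
  have ha0 : ‖(a : ℝ)‖ ≠ 0 := norm_ne_zero_iff.mpr a.ne_zero
  rw [stretch, ← ha, Units.smul_def, map_smul, norm_smul, norm_smul, mul_div_mul_left _ _ ha0]

theorem dProj_mk {d : ℕ} (v w : Euc d) (hv : v ≠ 0) (hw : w ≠ 0) :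
    dProj (Projectivization.mk ℝ v hv) (Projectivization.mk ℝ w hw)
      = Real.sqrt (1 - (inner ℝ v w / (‖v‖ * ‖w‖)) ^ 2) := by
  obtain ⟨a, ha⟩ := Projectivization.exists_smul_eq_mk_rep ℝ v hv
  obtain ⟨b, hb⟩ := Projectivization.exists_smul_eq_mk_rep ℝ w hw
  have ha0 : (a : ℝ) ≠ 0 := a.ne_zero
  have hb0 : (b : ℝ) ≠ 0 := b.ne_zero
  have hv0 : ‖v‖ ≠ 0 := norm_ne_zero_iff.mpr hv
  have hw0 : ‖w‖ ≠ 0 := norm_ne_zero_iff.mpr hw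
  rw [dProj, ← ha, ← hb, Units.smul_def, Units.smul_def, norm_smul, norm_smul,
    real_inner_smul_left, real_inner_smul_right]
  congr 2
  rw [div_pow, div_pow, mul_pow, mul_pow, mul_pow, mul_pow, mul_pow, mul_pow,
    Real.norm_eq_abs, Real.norm_eq_abs, sq_abs, sq_abs]
  field_simp

/-! ### Strong irreducibility and contraction -/

/-- The semigroup of all finite products (the empty one included) of matrices in `S`. -/
def semigroup {d : ℕ} (S : Set (GL (Fin d) ℝ)) : Set (GL (Fin d) ℝ) :=
  (Submonoid.closure S : Set (GL (Fin d) ℝ))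

/-- Strong irreducibility: no finite non-empty family of proper (non-zero, and not the whole space)
linear subspaces has a union that is preserved by every element of the semigroup. -/
def StronglyIrreducible {d : ℕ} (S : Set (GL (Fin d) ℝ)) : Prop :=
  ¬ ∃ F : Finset (Submodule ℝ (Euc d)), F.Nonempty ∧ (∀ V ∈ F, V ≠ ⊥ ∧ V ≠ ⊤) ∧
    ∀ A ∈ semigroup S,
      lin A '' (⋃ V ∈ F, (V : Set (Euc d))) = ⋃ V ∈ F, (V : Set (Euc d))

/-- Contraction: there are `A₁, A₂, …` in the semigroup for which `Aₙ / ‖Aₙ‖` converges to a matrix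
of rank one. -/
def Contracting {d : ℕ} (S : Set (GL (Fin d) ℝ)) : Prop :=
  ∃ (A : ℕ → GL (Fin d) ℝ) (R : Matrix (Fin d) (Fin d) ℝ),
    (∀ n, A n ∈ semigroup S) ∧ R.rank = 1 ∧
    Tendsto (fun n => ‖LinearMap.toContinuousLinearMap (lin (A n))‖⁻¹ •
      (A n : Matrix (Fin d) (Fin d) ℝ)) atTop (𝓝 R)

/-! ### The function space and the transfer operators -/

/-- The space `G_{θ,α}`: functions that are Lipschitz in `ω`, uniformly in `x`, and `α`-Hölder in
`x`, uniformly in `ω`. -/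
def G (k d : ℕ) (θ α : ℝ) : Set (Seq k × Proj d → ℂ) :=
  {f | (∃ C > 0, ∀ (x : Proj d) (ω ω' : Seq k), ‖f (ω, x) - f (ω', x)‖ ≤ C * dSeq θ ω ω') ∧
    (∃ C > 0, ∀ (ω : Seq k) (x y : Proj d), ‖f (ω, x) - f (ω, y)‖ ≤ C * dProj x y ^ α)}

/-- The seminorm `|f|_{θ,α}`. -/
def lipNorm {k d : ℕ} (θ α : ℝ) (f : Seq k × Proj d → ℂ) : ℝ :=
  sSup {r | ∃ (ω ω' : Seq k) (x y : Proj d), (ω ≠ ω' ∨ x ≠ y) ∧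
    r = ‖f (ω, x) - f (ω', y)‖ / (dProj x y ^ α + dSeq θ ω ω')}

/-- The supremum norm `|f|_∞`. -/
def supNorm {k d : ℕ} (f : Seq k × Proj d → ℂ) : ℝ := ⨆ z, ‖f z‖

/-- The transfer operator
`(L_t w)(ω, x) = ∑_{σ ω' = ω} p(ω, ω') e^{t log ‖M(ω') x‖} w(ω', M(ω') · x)`;
the sum runs over the preimages `ω' = i ω` of `ω`. -/
def transferOp {k d : ℕ} (μ : Measure (Seq k)) (M : Seq k → GL (Fin d) ℝ) (t : ℂ)
    (w : Seq k × Proj d → ℂ) : Seq k × Proj d → ℂ :=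
  fun z => ∑ i : Fin k,
    (condProb μ z.1 (cons i z.1) : ℂ) *
      Complex.exp (t * (Real.log (stretch (M (cons i z.1)) z.2) : ℂ)) *
      w (cons i z.1, act (M (cons i z.1)) z.2)

end MarkovMatrixProduct

end

/-! The estimate is a Doeblin–Fortet inequality. For imaginary `t` the factors `e^{t log ‖M x‖}`
have modulus one, so under iteration the oscillation in `ω` gains a factor `θ` per step, and the
oscillation in `x` is controlled by the average, over the backward Markov chain, of a power of the
distance between the images of two points. What is needed is contraction on average: a function `F`
of a letter and a pair of points, comparable with `dProj ^ β`, with `avgOp F ≤ ρ F` and `ρ < 1`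
(`exists_contracted_dProj`). Jensen's inequality passes this to `F ^ γ` for `γ ≤ 1`, which covers
all small `α`; `transferOp_iterate_bound` then sums a geometric series.

Lyapunov exponents are not used; `F` comes from an optimal stopping problem. The adjoint action on
the unit sphere has stationary measures (`exists_stationary`), which by strong irreducibility do not
charge proper subspaces (`measureReal_sphereInter_eq_zero`). The masses they give to the sets
`dualBand` are harmonic along words and initially small. If a product increases the distance of two
points by more than a fixed factor, it stretches one of them far less than its norm permits, and the
corresponding mass is then large (`opNorm_le_of_measureReal_dualBand_lt`). So a large increase has
probability at most one half. Restarting whenever such an increase occurs bounds the stopping value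
of a small power of the distance by a multiple of that power (`snell_le`), and the limiting value is
superharmonic.

Strictness comes from the contraction hypothesis: along some word of bounded length the distance of
any given pair shrinks by any prescribed factor (`exists_word_area_le`). The square root of the
superharmonic function therefore has a definite variance after that many steps, hence a definite
loss in mean; a sum of its iterates is contracted in one step (`exists_contracted`). -/

namespace MarkovMatrixProduct

/-! ### Contraction on average for a cocycle over a finite Markov chain -/

section Averaging

variable {k : ℕ} {Y : Type*}

/-- The Markov operator `f ↦ ((j, y) ↦ ∑ i, P i j * f i (T i y))`. -/
def avgOp (P : Fin k → Fin k → ℝ) (T : Fin k → Y → Y) (f : Fin k → Y → ℝ) : Fin k → Y → ℝ :=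
  fun j y => ∑ i, P i j * f i (T i y)

/-- The composition of the maps `T i` along a word; the last letter acts first. -/
def wordMap (T : Fin k → Y → Y) (w : List (Fin k)) (y : Y) : Y := w.foldr T y

@[simp] theorem wordMap_nil (T : Fin k → Y → Y) (y : Y) : wordMap T [] y = y := rfl

@[simp] theorem wordMap_cons (T : Fin k → Y → Y) (i : Fin k) (w : List (Fin k)) (y : Y) :
    wordMap T (i :: w) y = T i (wordMap T w y) := rfl

theorem wordMap_concat (T : Fin k → Y → Y) (i : Fin k) (w : List (Fin k)) (y : Y) :
    wordMap T (w ++ [i]) y = wordMap T w (T i y) := by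
  simp [wordMap]

variable {P : Fin k → Fin k → ℝ} {T : Fin k → Y → Y}

theorem avgOp_mono (hP : ∀ i j, 0 ≤ P i j) {f g : Fin k → Y → ℝ} (h : ∀ j y, f j y ≤ g j y)
    (j : Fin k) (y : Y) : avgOp P T f j y ≤ avgOp P T g j y :=
  Finset.sum_le_sum fun i _ => mul_le_mul_of_nonneg_left (h _ _) (hP i j)

theorem avgOp_iterate_mono (hP : ∀ i j, 0 ≤ P i j) {f g : Fin k → Y → ℝ}
    (h : ∀ j y, f j y ≤ g j y) (n : ℕ) :
    ∀ j y, (avgOp P T)^[n] f j y ≤ (avgOp P T)^[n] g j y := by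
  induction n with
  | zero => exact h
  | succ n ih =>
    intro j y
    rw [Function.iterate_succ_apply', Function.iterate_succ_apply']
    exact avgOp_mono hP ih j y

theorem avgOp_iterate_antitone (hP : ∀ i j, 0 ≤ P i j) {f : Fin k → Y → ℝ}
    (h : ∀ j y, avgOp P T f j y ≤ f j y) {m n : ℕ} (hmn : m ≤ n) (j : Fin k) (y : Y) :
    (avgOp P T)^[n] f j y ≤ (avgOp P T)^[m] f j y := by
  induction n, hmn using Nat.le_induction with
  | base => rfl
  | succ n _ ih =>
    refine le_trans ?_ ih
    rw [Function.iterate_succ_apply]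
    exact avgOp_iterate_mono hP h n j y

/-- Used to expand the mean of a square `(Φ - s) ^ 2` into the means of `Φ ^ 2` and `Φ`. -/
theorem avgOp_iterate_combo (a b c : ℝ) (hP1 : ∀ j, ∑ i, P i j = 1) (f g : Fin k → Y → ℝ) (n : ℕ) :
    ∀ j y, (avgOp P T)^[n] (fun j y => a * f j y + b * g j y + c) j y
      = a * (avgOp P T)^[n] f j y + b * (avgOp P T)^[n] g j y + c := by
  induction n with
  | zero => intro j y; rfl
  | succ n ih =>
    intro j y
    simp only [Function.iterate_succ_apply']
    conv_lhs => rw [avgOp]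
    simp only [ih, avgOp, mul_add, Finset.sum_add_distrib, ← Finset.sum_mul, hP1, one_mul,
      Finset.mul_sum]
    congr 2 <;> refine Finset.sum_congr rfl fun i _ => by ring

/-- An iterate of the Markov operator is bounded below by the contribution of one word. -/
theorem pow_mul_le_avgOp_iterate {p : ℝ} (hp : 0 ≤ p) (hP : ∀ i j, p ≤ P i j)
    {f : Fin k → Y → ℝ} (hf : ∀ j y, 0 ≤ f j y) {m : ℝ} (w : List (Fin k)) :
    ∀ j y, (∀ i, m ≤ f i (wordMap T w y)) →
      p ^ w.length * m ≤ (avgOp P T)^[w.length] f j y := by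
  have hP0 : ∀ i j, 0 ≤ P i j := fun i j => hp.trans (hP i j)
  have hnn : ∀ n j y, 0 ≤ (avgOp P T)^[n] f j y := by
    intro n
    induction n with
    | zero => exact hf
    | succ n ih =>
      intro j y
      rw [Function.iterate_succ_apply']
      exact Finset.sum_nonneg fun i _ => mul_nonneg (hP0 i j) (ih _ _)
  induction w using List.reverseRecOn with
  | nil => intro j y h; simpa using h j
  | append_singleton w i ih =>
    intro j y h
    simp only [wordMap_concat] at h
    rw [List.length_append, List.length_singleton, Function.iterate_succ_apply', pow_succ']
    refine le_trans ?_ (Finset.single_le_sum (f := fun i => P i j * (avgOp P T)^[w.length] f i (T i y))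
      (fun i _ => mul_nonneg (hP0 i j) (hnn _ _ _)) (Finset.mem_univ i))
    have := ih i (T i y) h
    calc p * p ^ w.length * m = p * (p ^ w.length * m) := by ring
      _ ≤ p * (avgOp P T)^[w.length] f i (T i y) := mul_le_mul_of_nonneg_left this hp
      _ ≤ _ := mul_le_mul_of_nonneg_right (hP i j) (hnn _ _ _)

/-! ### Optimal stopping and the maximal inequality -/

/-- The value, over at most `n` steps, of the optimal stopping problem with reward `f`. -/
def snell (P : Fin k → Fin k → ℝ) (T : Fin k → Y → Y) (f : Y → ℝ) : ℕ → Fin k → Y → ℝ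
  | 0 => fun _ y => f y
  | n + 1 => fun j y => max (f y) (avgOp P T (snell P T f n) j y)

theorem le_snell (f : Y → ℝ) (n : ℕ) (j : Fin k) (y : Y) : f y ≤ snell P T f n j y := by
  cases n
  · exact le_rfl
  · exact le_max_left _ _

theorem snell_mono (hP : ∀ i j, 0 ≤ P i j) (f : Y → ℝ) (n : ℕ) :
    ∀ j y, snell P T f n j y ≤ snell P T f (n + 1) j y := by
  induction n with
  | zero => exact fun j y => le_max_left _ _
  | succ n ih => exact fun j y => max_le_max le_rfl (avgOp_mono hP ih j y)

/-- The maximal inequality: if the reward `D ^ β` is unlikely to exceed a multiple of its initial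
value, as witnessed by the harmonic functions `H`, then the value of the optimal stopping problem
is bounded by a multiple of `D ^ β`. -/
theorem snell_le {D : Y → ℝ} (hD : ∀ y, 0 ≤ D y) {c l β : ℝ} (hc : 1 ≤ c) (hl : 1 ≤ l)
    (hβ : 0 < β) (hclβ : (c * l) ^ β ≤ 3 / 2)
    (hP : ∀ i j, 0 ≤ P i j) (hP1 : ∀ j, ∑ i, P i j = 1)
    (hDT : ∀ i y, D (T i y) ≤ c * D y)
    (hH : ∀ y, ∃ H : Fin k → List (Fin k) → ℝ, (∀ j w, 0 ≤ H j w) ∧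
      (∀ j w, H j w = ∑ i, P i j * H i (i :: w)) ∧ (∀ j, H j [] ≤ 1 / 2) ∧
      ∀ j w, l * D y < D (wordMap T w y) → 1 ≤ H j w) (n : ℕ) :
    ∀ j y, snell P T (fun y => D y ^ β) n j y ≤ 4 * l ^ β * D y ^ β := by
  have hlβ : 1 ≤ l ^ β := Real.one_le_rpow hl hβ.le
  have hl0 : 0 ≤ l := by linarith
  -- Strong induction, because the process is restarted with whatever horizon remains when `D` first
  -- exceeds its level.
  induction n using Nat.strong_induction_on with
  | _ n IH =>
  intro j y
  have hDy : 0 ≤ D y ^ β := Real.rpow_nonneg (hD y) _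
  cases n with
  | zero =>
    change D y ^ β ≤ _
    nlinarith
  | succ n =>
    obtain ⟨H, hH0, hHh, hH1, hH2⟩ := hH y
    set K := 4 * l ^ β with hK
    -- The right-hand side is affine in `H`, hence harmonic in the word. Below the level `l * D y`
    -- it dominates the reward; above the level `1 ≤ H`, and the induction hypothesis at the new
    -- point takes over. One step overshoots by at most a factor `c`, whence the range `c * l * D
    -- y`.
    have key : ∀ m ≤ n, ∀ j w, D (wordMap T w y) ≤ c * l * D y →
        snell P T (fun y => D y ^ β) m j (wordMap T w y)
          ≤ D y ^ β * (l ^ β + (c * l) ^ β * K * H j w) := by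
      intro m
      induction m with
      | zero =>
        intro hm j w hw
        by_cases hlw : D (wordMap T w y) ≤ l * D y
        · calc D (wordMap T w y) ^ β ≤ (l * D y) ^ β := Real.rpow_le_rpow (hD _) hlw hβ.le
            _ = D y ^ β * l ^ β := by rw [Real.mul_rpow hl0 (hD _), mul_comm]
            _ ≤ _ := by
              refine mul_le_mul_of_nonneg_left ?_ hDy
              have : 0 ≤ (c * l) ^ β * K * H j w := by have := hH0 j w; positivity
              linarith
        · have h1 := hH2 j w (not_le.1 hlw)
          have h2 := IH 0 (by omega) j (wordMap T w y)
          have h3 : D (wordMap T w y) ^ β ≤ (c * l) ^ β * D y ^ β := by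
            rw [← Real.mul_rpow (by positivity) (hD _)]
            exact Real.rpow_le_rpow (hD _) hw hβ.le
          calc _ ≤ K * D (wordMap T w y) ^ β := h2
            _ ≤ K * ((c * l) ^ β * D y ^ β) := by gcongr
            _ = D y ^ β * ((c * l) ^ β * K * 1) := by ring
            _ ≤ D y ^ β * ((c * l) ^ β * K * H j w) := by gcongr
            _ ≤ _ := by
              refine mul_le_mul_of_nonneg_left ?_ hDy
              linarith
      | succ m ihm =>
        intro hm j w hw
        by_cases hlw : D (wordMap T w y) ≤ l * D y
        · refine max_le ?_ ?_
          · calc D (wordMap T w y) ^ β ≤ (l * D y) ^ β := Real.rpow_le_rpow (hD _) hlw hβ.le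
              _ = D y ^ β * l ^ β := by rw [Real.mul_rpow hl0 (hD _), mul_comm]
              _ ≤ _ := by
                refine mul_le_mul_of_nonneg_left ?_ hDy
                have : 0 ≤ (c * l) ^ β * K * H j w := by have := hH0 j w; positivity
                linarith
          · calc avgOp P T (snell P T (fun y => D y ^ β) m) j (wordMap T w y)
                ≤ ∑ i, P i j * (D y ^ β * (l ^ β + (c * l) ^ β * K * H i (i :: w))) := by
                  refine Finset.sum_le_sum fun i _ => mul_le_mul_of_nonneg_left ?_ (hP i j)
                  rw [← wordMap_cons T]
                  refine ihm (by omega) i (i :: w) ?_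
                  rw [wordMap_cons]
                  calc _ ≤ c * D (wordMap T w y) := hDT _ _
                    _ ≤ c * (l * D y) := by gcongr
                    _ = _ := by ring
              _ = D y ^ β * ((∑ i, P i j) * l ^ β
                    + (c * l) ^ β * K * ∑ i, P i j * H i (i :: w)) := by
                  rw [Finset.sum_mul, Finset.mul_sum, ← Finset.sum_add_distrib, Finset.mul_sum]
                  exact Finset.sum_congr rfl fun i _ => by ring
              _ = _ := by rw [hP1, one_mul, ← hHh]
        · have h1 := hH2 j w (not_le.1 hlw)
          have h2 := IH (m + 1) (by omega) j (wordMap T w y)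
          have h3 : D (wordMap T w y) ^ β ≤ (c * l) ^ β * D y ^ β := by
            rw [← Real.mul_rpow (by positivity) (hD _)]
            exact Real.rpow_le_rpow (hD _) hw hβ.le
          calc _ ≤ K * D (wordMap T w y) ^ β := h2
            _ ≤ K * ((c * l) ^ β * D y ^ β) := by gcongr
            _ = D y ^ β * ((c * l) ^ β * K * 1) := by ring
            _ ≤ D y ^ β * ((c * l) ^ β * K * H j w) := by gcongr
            _ ≤ _ := by
              refine mul_le_mul_of_nonneg_left ?_ hDy
              linarith
    -- `key` covers only horizons up to `n`, so the first step from `y` is made by hand.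
    refine max_le (by nlinarith) ?_
    calc avgOp P T (snell P T (fun y => D y ^ β) n) j y
        ≤ ∑ i, P i j * (D y ^ β * (l ^ β + (c * l) ^ β * K * H i [i])) := by
          refine Finset.sum_le_sum fun i _ => mul_le_mul_of_nonneg_left ?_ (hP i j)
          refine key n le_rfl i [i] ?_
          rw [wordMap_cons, wordMap_nil]
          refine (hDT _ _).trans ?_
          have := hD y
          nlinarith [mul_nonneg (by linarith : (0 : ℝ) ≤ c) this]
      _ = D y ^ β * ((∑ i, P i j) * l ^ β + (c * l) ^ β * K * ∑ i, P i j * H i [i]) := by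
          rw [Finset.sum_mul, Finset.mul_sum, ← Finset.sum_add_distrib, Finset.mul_sum]
          exact Finset.sum_congr rfl fun i _ => by ring
      _ = D y ^ β * (l ^ β + (c * l) ^ β * K * H j []) := by rw [hP1, one_mul, ← hHh]
      -- The factor 4 in `K` solves `K = l ^ β + (3 / 4) * K`.
      _ ≤ D y ^ β * (l ^ β + 3 / 2 * K * (1 / 2)) := by
          have := hH1 j
          have := hH0 j []
          gcongr
      _ = K * D y ^ β := by rw [hK]; ring

/-- A bounded optimal stopping problem has a superharmonic value function. -/
theorem exists_superharmonic (hP : ∀ i j, 0 ≤ P i j) (f g : Y → ℝ)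
    (h : ∀ n j y, snell P T f n j y ≤ g y) :
    ∃ F : Fin k → Y → ℝ, (∀ j y, f y ≤ F j y) ∧ (∀ j y, F j y ≤ g y) ∧
      ∀ j y, avgOp P T F j y ≤ F j y := by
  have hmono : ∀ j y, Monotone fun n => snell P T f n j y :=
    fun j y => monotone_nat_of_le_succ fun n => snell_mono hP f n j y
  have hlim : ∀ j y, Tendsto (fun n => snell P T f n j y) atTop
      (𝓝 (⨆ n, snell P T f n j y)) := fun j y =>
    tendsto_atTop_ciSup (hmono j y) ⟨g y, by rintro _ ⟨n, rfl⟩; exact h n j y⟩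
  refine ⟨fun j y => ⨆ n, snell P T f n j y, fun j y => ?_, fun j y => ciSup_le fun n => h n j y,
    fun j y => ?_⟩
  · exact ge_of_tendsto' (hlim j y) fun n => le_snell f n j y
  · have h1 : Tendsto (fun n => avgOp P T (snell P T f n) j y) atTop
        (𝓝 (avgOp P T (fun j y => ⨆ n, snell P T f n j y) j y)) :=
      tendsto_finsetSum _ fun i _ => (hlim i (T i y)).const_mul _
    exact le_of_tendsto_of_tendsto' h1 ((hlim j y).comp (tendsto_add_atTop_nat 1))
      fun n => le_max_right _ _

/-- Jensen's inequality for the Markov operator. -/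
theorem avgOp_rpow_le (hP : ∀ i j, 0 ≤ P i j) (hP1 : ∀ j, ∑ i, P i j = 1) {F : Fin k → Y → ℝ}
    (hF : ∀ j y, 0 ≤ F j y) {γ : ℝ} (hγ : 0 < γ) (hγ1 : γ ≤ 1) (j : Fin k) (y : Y) :
    avgOp P T (fun j y => F j y ^ γ) j y ≤ avgOp P T F j y ^ γ :=
  (Real.concaveOn_rpow hγ.le hγ1).le_map_sum (fun i _ => hP i j) (hP1 j)
    (fun i _ => hF i (T i y))

/-! ### From superharmonicity to strict contraction -/

/-- Contraction on average: if the growth of `D` is controlled by harmonic functions, and `D` can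
be made arbitrarily small along words of bounded length, then some function comparable with a
power of `D` is contracted by the Markov operator. -/
theorem exists_contracted {D : Y → ℝ} (hD : ∀ y, 0 ≤ D y) {c l p : ℝ} (hc : 1 ≤ c) (hl : 1 ≤ l)
    (hp : 0 < p) (hP : ∀ i j, p ≤ P i j) (hP1 : ∀ j, ∑ i, P i j = 1)
    (hDT : ∀ i y, D (T i y) ≤ c * D y)
    (hH : ∀ y, ∃ H : Fin k → List (Fin k) → ℝ, (∀ j w, 0 ≤ H j w) ∧
      (∀ j w, H j w = ∑ i, P i j * H i (i :: w)) ∧ (∀ j, H j [] ≤ 1 / 2) ∧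
      ∀ j w, l * D y < D (wordMap T w y) → 1 ≤ H j w)
    (hcon : ∀ δ > 0, ∃ N : ℕ, ∀ y, ∃ w : List (Fin k), w.length ≤ N ∧
      D (wordMap T w y) ≤ δ * D y) :
    ∃ β K ρ : ℝ, 0 < β ∧ β ≤ 1 ∧ 0 < ρ ∧ ρ < 1 ∧ ∃ F : Fin k → Y → ℝ,
      ∀ j y, D y ^ β ≤ F j y ∧ F j y ≤ K * D y ^ β ∧ avgOp P T F j y ≤ ρ * F j y := by
  have hP0 : ∀ i j, 0 ≤ P i j := fun i j => hp.le.trans (hP i j)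
  obtain ⟨β, hβ, hβ1, hclβ⟩ : ∃ β : ℝ, 0 < β ∧ β ≤ 1 ∧ (c * l) ^ β ≤ 3 / 2 := by
    have hcl : c * l ≠ 0 := by positivity
    have h1 : Tendsto (fun β : ℝ => (c * l) ^ β) (𝓝[>] 0) (𝓝 ((c * l) ^ (0 : ℝ))) :=
      ((Real.continuous_const_rpow hcl).tendsto 0).mono_left nhdsWithin_le_nhds
    rw [Real.rpow_zero] at h1
    obtain ⟨β, h2, h3⟩ := ((h1.eventually_le_const (by norm_num : (1 : ℝ) < 3 / 2)).and
      (Ioc_mem_nhdsGT one_pos)).exists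
    exact ⟨β, h3.1, h3.2, h2⟩
  obtain ⟨Ψ, hΨ1, hΨ2, hΨ3⟩ := exists_superharmonic hP0 (fun y => D y ^ β)
    (fun y => 4 * l ^ β * D y ^ β)
    (fun n j y => snell_le hD hc hl hβ hclβ hP0 hP1 hDT hH n j y)
  set K := 4 * l ^ β with hK
  have hK0 : 0 < K := by positivity
  have hΨ0 : ∀ j y, 0 ≤ Ψ j y := fun j y => (Real.rpow_nonneg (hD y) _).trans (hΨ1 j y)
  -- `Ψ` may be merely superharmonic. Its square root gains strictly, since both `Φ` and `Φ ^ 2` are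
  -- superharmonic and a lower bound on the variance becomes a loss in the mean.
  set Φ : Fin k → Y → ℝ := fun j y => √(Ψ j y) with hΦ
  have hΦ0 : ∀ j y, 0 ≤ Φ j y := fun j y => Real.sqrt_nonneg _
  have hΦΨ : ∀ j y, Φ j y ^ 2 = Ψ j y := fun j y => Real.sq_sqrt (hΨ0 j y)
  have hΦsup : ∀ j y, avgOp P T Φ j y ≤ Φ j y := by
    intro j y
    have := avgOp_rpow_le (T := T) hP0 hP1 hΨ0 (by norm_num : (0 : ℝ) < 1 / 2) (by norm_num) j y
    simp only [← Real.sqrt_eq_rpow] at this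
    exact this.trans (Real.sqrt_le_sqrt (hΨ3 j y))
  -- Shrinking `D` by `δ` divides `Ψ` by at least 4, hence `Φ` by at least 2.
  obtain ⟨δ, hδ, hδ1⟩ : ∃ δ : ℝ, 0 < δ ∧ K * δ ^ β ≤ 1 / 4 := by
    refine ⟨(1 / (4 * K)) ^ (1 / β), by positivity, ?_⟩
    rw [← Real.rpow_mul (by positivity), one_div_mul_cancel hβ.ne', Real.rpow_one]
    field_simp
    norm_num
  obtain ⟨N, hN⟩ := hcon δ hδ
  have hp1 : ∀ y : Fin k, p ≤ 1 := fun j => by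
    rw [← hP1 j]
    exact (hP j j).trans (Finset.single_le_sum (f := fun i => P i j) (fun i _ => hP0 i j)
      (Finset.mem_univ j))
  have hgap : ∀ j y, (avgOp P T)^[N + 1] Φ j y ≤ (1 - p ^ N / 8) * Φ j y := by
    intro j y
    obtain ⟨w, hwN, hw⟩ := hN y
    refine (avgOp_iterate_antitone hP0 hΦsup (hwN.trans (Nat.le_succ N)) j y).trans ?_
    set s := Φ j y with hs
    have hs0 : 0 ≤ s := hΦ0 j y
    have hpw : p ^ N ≤ p ^ w.length := pow_le_pow_of_le_one hp.le (hp1 j) hwN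
    rcases hs0.eq_or_lt with h0 | hspos
    -- The case `s = 0` is separate because the variance bound is divided by `s` below.
    · rw [← h0, mul_zero, h0]
      simpa using avgOp_iterate_antitone hP0 hΦsup (Nat.zero_le w.length) j y
    have h1 : ∀ i, s ^ 2 / 4 ≤ (Φ i (wordMap T w y) - s) ^ 2 := by
      intro i
      have h2 : Φ i (wordMap T w y) ^ 2 ≤ (s / 2) ^ 2 := by
        rw [hΦΨ, div_pow, hs, hΦΨ]
        calc Ψ i (wordMap T w y) ≤ K * D (wordMap T w y) ^ β := hΨ2 _ _
          _ ≤ K * (δ * D y) ^ β := by have := hD (wordMap T w y); gcongr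
          _ = K * δ ^ β * D y ^ β := by rw [Real.mul_rpow hδ.le (hD y)]; ring
          _ ≤ 1 / 4 * D y ^ β := by have := Real.rpow_nonneg (hD y) β; gcongr
          _ ≤ 1 / 4 * Ψ j y := by have := hΨ1 j y; gcongr
          _ = _ := by ring
      have h3 : Φ i (wordMap T w y) ≤ s / 2 := (sq_le_sq₀ (hΦ0 _ _) (by positivity)).1 h2
      have h4 := hΦ0 i (wordMap T w y)
      nlinarith
    -- The single word `w` already contributes at least `p ^ w.length * s ^ 2 / 4` to the mean of
    -- `(Φ - s) ^ 2`, while superharmonicity bounds that mean by `2 * s ^ 2` minus `2 * s` times the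
    -- mean of `Φ`.
    have h2 := pow_mul_le_avgOp_iterate (T := T) hp.le hP
      (f := fun i z => (Φ i z - s) ^ 2) (fun _ _ => sq_nonneg _) w j y h1
    have h3 : (fun i z => (Φ i z - s) ^ 2)
        = fun i z => (1 : ℝ) * Ψ i z + (-(2 * s)) * Φ i z + s ^ 2 := by
      funext i z; rw [← hΦΨ]; ring
    rw [h3, avgOp_iterate_combo _ _ _ hP1] at h2
    have h4 : (avgOp P T)^[w.length] Ψ j y ≤ s ^ 2 := by
      rw [hs, hΦΨ]
      exact avgOp_iterate_antitone hP0 hΨ3 (Nat.zero_le w.length) j y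
    have h5 : p ^ N * (s ^ 2 / 4) ≤ p ^ w.length * (s ^ 2 / 4) := by gcongr
    refine le_of_mul_le_mul_left ?_ hspos
    nlinarith
  have hF : ∀ j y, avgOp P T (fun j y => ∑ m ∈ Finset.range (N + 1), (avgOp P T)^[m] Φ j y) j y
      = ∑ m ∈ Finset.range (N + 1), (avgOp P T)^[m + 1] Φ j y := by
    intro j y
    simp only [Function.iterate_succ_apply']
    simp only [avgOp, Finset.mul_sum]
    rw [Finset.sum_comm]
  have hle : ∀ j y, ∑ m ∈ Finset.range (N + 1), (avgOp P T)^[m] Φ j y ≤ (N + 1) * Φ j y := by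
    intro j y
    refine (Finset.sum_le_card_nsmul _ _ (Φ j y) fun m _ =>
      avgOp_iterate_antitone hP0 hΦsup (Nat.zero_le m) j y).trans ?_
    simp
  have hnn : ∀ m j y, 0 ≤ (avgOp P T)^[m] Φ j y := by
    intro m
    induction m with
    | zero => exact hΦ0
    | succ m ih =>
      intro j y
      rw [Function.iterate_succ_apply']
      exact Finset.sum_nonneg fun i _ => mul_nonneg (hP0 i j) (ih _ _)
  have hpN : ∀ j : Fin k, p ^ N ≤ 1 := fun j => pow_le_one₀ hp.le (hp1 j)
  -- The exponent is halved by the square root. Applying the operator to the sum of iterates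
  -- replaces its term `Φ` by the iterate of order `N + 1`, so the `N + 1`-step loss becomes a
  -- one-step loss. The minimum with 1 keeps the rate positive even if there are no letters, when `p
  -- ≤ 1` is unavailable.
  refine ⟨β / 2, (N + 1) * √K, 1 - min (p ^ N) 1 / 8 / (N + 1), by positivity, by linarith, ?_, ?_,
    fun j y => ∑ m ∈ Finset.range (N + 1), (avgOp P T)^[m] Φ j y, fun j y => ⟨?_, ?_, ?_⟩⟩
  · have h1 : min (p ^ N) 1 / 8 / ((N : ℝ) + 1) ≤ min (p ^ N) 1 / 8 :=
      div_le_self (by positivity) (by linarith [(Nat.cast_nonneg N : (0 : ℝ) ≤ N)])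
    have h2 : min (p ^ N) 1 ≤ 1 := min_le_right _ _
    linarith
  · have : 0 < min (p ^ N) 1 / 8 / ((N : ℝ) + 1) := by positivity
    linarith
  · refine le_trans ?_ (Finset.single_le_sum (fun m _ => hnn m j y) (Finset.mem_range.2 N.succ_pos))
    change _ ≤ √(Ψ j y)
    have h1 : D y ^ (β / 2) = √(D y ^ β) := by
      rw [Real.sqrt_eq_rpow, ← Real.rpow_mul (hD y)]; ring_nf
    rw [h1]
    exact Real.sqrt_le_sqrt (hΨ1 j y)
  · refine (hle j y).trans ?_
    have h1 : D y ^ (β / 2) = √(D y ^ β) := by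
      rw [Real.sqrt_eq_rpow, ← Real.rpow_mul (hD y)]; ring_nf
    rw [h1, mul_assoc, ← Real.sqrt_mul hK0.le]
    refine mul_le_mul_of_nonneg_left (Real.sqrt_le_sqrt (hΨ2 j y)) (by positivity)
  · rw [hF, min_eq_left (hpN j)]
    have h1 := Finset.sum_range_succ (fun m => (avgOp P T)^[m] Φ j y) (N + 1)
    rw [Finset.sum_range_succ'] at h1
    have h2 := hgap j y
    have h3 := hle j y
    simp only [Function.iterate_zero, id] at h1
    set S := ∑ m ∈ Finset.range (N + 1), (avgOp P T)^[m] Φ j y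
    have h4 : p ^ N / 8 / (N + 1) * S ≤ p ^ N / 8 * Φ j y := by
      calc p ^ N / 8 / (N + 1) * S ≤ p ^ N / 8 / (N + 1) * ((N + 1) * Φ j y) := by gcongr
        _ = _ := by field_simp
    linarith

end Averaging

/-! ### Stationary measures -/

section Stationary

variable {k : ℕ} {X : Type*} [TopologicalSpace X] [MeasurableSpace X] [BorelSpace X]

/-- The operator on families of measures dual to `avgOp P B`. -/
noncomputable def avgMeasure (P : Fin k → Fin k → ℝ) (B : Fin k → X → X) (ν : Fin k → Measure X) :
    Fin k → Measure X :=
  fun j => ∑ i, ENNReal.ofReal (P i j) • (ν i).map (B i)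

variable {P : Fin k → Fin k → ℝ} {B : Fin k → X → X}

theorem isProbabilityMeasure_avgMeasure (hP : ∀ i j, 0 ≤ P i j) (hP1 : ∀ j, ∑ i, P i j = 1)
    (hB : ∀ i, Continuous (B i)) {ν : Fin k → Measure X} (hν : ∀ j, IsProbabilityMeasure (ν j))
    (j : Fin k) : IsProbabilityMeasure (avgMeasure P B ν j) := by
  refine ⟨?_⟩
  rw [avgMeasure, Measure.finsetSum_apply]
  have : ∀ i, (ν i).map (B i) Set.univ = 1 := fun i =>
    (Measure.isProbabilityMeasure_map (hB i).measurable.aemeasurable).measure_univ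
  simp only [Measure.smul_apply, this, smul_eq_mul, mul_one]
  rw [← ENNReal.ofReal_sum_of_nonneg fun i _ => hP i j, hP1, ENNReal.ofReal_one]

theorem integral_avgMeasure [CompactSpace X] (hP : ∀ i j, 0 ≤ P i j)
    (hB : ∀ i, Continuous (B i)) {ν : Fin k → Measure X} (hν : ∀ j, IsProbabilityMeasure (ν j))
    {f : X → ℝ} (hf : Continuous f) (j : Fin k) :
    ∫ x, f x ∂(avgMeasure P B ν j) = ∑ i, P i j * ∫ x, f (B i x) ∂(ν i) := by
  have hint : ∀ (μ : Measure X) [IsFiniteMeasure μ], Integrable f μ := fun μ _ =>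
    (BoundedContinuousFunction.mkOfCompact ⟨f, hf⟩).integrable μ
  have hfin : ∀ i, IsProbabilityMeasure ((ν i).map (B i)) := fun i =>
    Measure.isProbabilityMeasure_map (hB i).measurable.aemeasurable
  rw [avgMeasure, integral_finsetSum_measure fun i _ => (hint _).smul_measure ENNReal.ofReal_ne_top]
  refine Finset.sum_congr rfl fun i _ => ?_
  rw [integral_smul_measure, ENNReal.toReal_ofReal (hP i j), smul_eq_mul,
    integral_map (hB i).measurable.aemeasurable (hint _).aestronglyMeasurable]

/-- Existence of stationary measures for a finite Markov chain of continuous maps of a compact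
space, as limits of averages along the orbit of a given point. -/
theorem exists_stationary [CompactSpace X] [T2Space X] [HasOuterApproxClosed X]
    (hP : ∀ i j, 0 ≤ P i j) (hP1 : ∀ j, ∑ i, P i j = 1) (hB : ∀ i, Continuous (B i)) (b : X) :
    ∃ ν : Fin k → Measure X, (∀ j, IsProbabilityMeasure (ν j)) ∧
      (∀ j s, MeasurableSet s → (ν j).real s = ∑ i, P i j * (ν i).real (B i ⁻¹' s)) ∧
      ∀ f : X → ℝ, Continuous f → (∀ w : List (Fin k), f (wordMap B w b) = 0) →
        ∀ j, ∫ x, f x ∂(ν j) = 0 := by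
  -- Krylov–Bogolyubov: `e` is the orbit of the Dirac mass at `b` under the dual operator, and `c`
  -- below is its sequence of Cesàro averages.
  set e : ℕ → Fin k → Measure X := fun m => (avgMeasure P B)^[m] (fun _ => Measure.dirac b) with he
  have he1 : ∀ m j, e (m + 1) j = avgMeasure P B (e m) j := fun m j => by
    rw [he]; simp only [Function.iterate_succ_apply']
  have hep : ∀ m j, IsProbabilityMeasure (e m j) := by
    intro m
    induction m with
    | zero => intro j; change IsProbabilityMeasure (Measure.dirac b); infer_instance
    | succ m ih => intro j; rw [he1]; exact isProbabilityMeasure_avgMeasure hP hP1 hB ih j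
  have hint : ∀ (f : X → ℝ), Continuous f → ∀ (μ : Measure X) [IsFiniteMeasure μ],
    Integrable f μ := fun f hf μ _ => (BoundedContinuousFunction.mkOfCompact ⟨f, hf⟩).integrable μ
  set c : ℕ → Fin k → Measure X := fun n j =>
    ENNReal.ofReal ((n + 1 : ℝ)⁻¹) • ∑ m ∈ Finset.range (n + 1), e m j with hc
  have hcp : ∀ n j, IsProbabilityMeasure (c n j) := by
    intro n j
    refine ⟨?_⟩
    simp only [hc, Measure.smul_apply, Measure.finsetSum_apply, measure_univ, Finset.sum_const,
      Finset.card_range, smul_eq_mul, nsmul_eq_mul, mul_one]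
    rw [← ENNReal.ofReal_natCast, ← ENNReal.ofReal_mul (by positivity)]
    push_cast
    rw [inv_mul_cancel₀ (by positivity), ENNReal.ofReal_one]
  have hci : ∀ (f : X → ℝ), Continuous f → ∀ n j,
      ∫ x, f x ∂(c n j) = (n + 1 : ℝ)⁻¹ * ∑ m ∈ Finset.range (n + 1), ∫ x, f x ∂(e m j) := by
    intro f hf n j
    rw [hc, integral_smul_measure, ENNReal.toReal_ofReal (by positivity), smul_eq_mul,
      integral_finsetSum_measure fun m _ => hint f hf _]
  let c' : ℕ → Fin k → ProbabilityMeasure X := fun n j => ⟨c n j, hcp n j⟩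
  -- One ultrafilter makes the averages converge for all letters at once, without extracting
  -- subsequences.
  set U : Ultrafilter ℕ := hyperfilter ℕ
  have hlim : ∀ j, ∃ μ : ProbabilityMeasure X,
      Tendsto (fun n => c' n j) U (𝓝 μ) := fun j => by
    obtain ⟨μ, -, hμ⟩ := (isCompact_univ (X := ProbabilityMeasure X)).ultrafilter_le_nhds
      (U.map fun n => c' n j) (by simp)
    exact ⟨μ, hμ⟩
  choose ν hν using hlim
  have hνi : ∀ (f : X → ℝ), Continuous f → ∀ j,
      Tendsto (fun n => ∫ x, f x ∂(c n j)) U (𝓝 (∫ x, f x ∂(ν j : Measure X))) := fun f hf j =>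
    (ProbabilityMeasure.tendsto_iff_forall_integral_tendsto.1 (hν j))
      (BoundedContinuousFunction.mkOfCompact ⟨f, hf⟩)
  have hU : (U : Filter ℕ) ≤ atTop := Nat.hyperfilter_le_atTop
  have hstat : ∀ j, (ν j : Measure X) = avgMeasure P B (fun i => (ν i : Measure X)) j := by
    intro j
    have : IsProbabilityMeasure (avgMeasure P B (fun i => (ν i : Measure X)) j) :=
      isProbabilityMeasure_avgMeasure hP hP1 hB (fun i => inferInstance) j
    refine ext_of_forall_integral_eq_of_IsFiniteMeasure fun f => ?_
    have hf : Continuous f := f.continuous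
    rw [integral_avgMeasure hP hB (fun i => inferInstance) hf]
    have h1 := hνi f hf j
    have h2 : Tendsto (fun n => ∑ i, P i j * ∫ x, f (B i x) ∂(c n i)) U
        (𝓝 (∑ i, P i j * ∫ x, f (B i x) ∂(ν i : Measure X))) :=
      tendsto_finsetSum _ fun i _ => (hνi (fun x => f (B i x)) (hf.comp (hB i)) i).const_mul _
    -- The defect of stationarity of a Cesàro average telescopes to a boundary term of order `1 /
    -- n`.
    have h3 : ∀ n : ℕ, ∑ i, P i j * ∫ x, f (B i x) ∂(c n i) - ∫ x, f x ∂(c n j)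
        = (n + 1 : ℝ)⁻¹ * (∫ x, f x ∂(e (n + 1) j) - ∫ x, f x ∂(e 0 j)) := by
      intro n
      simp only [hci _ hf]
      have h4 : ∑ i, P i j * ((n + 1 : ℝ)⁻¹ * ∑ m ∈ Finset.range (n + 1),
            ∫ x, (f ∘ B i) x ∂(e m i))
          = (n + 1 : ℝ)⁻¹ * ∑ m ∈ Finset.range (n + 1), ∫ x, f x ∂(e (m + 1) j) := by
        simp only [he1, integral_avgMeasure hP hB (hep _) hf, Finset.mul_sum]
        rw [Finset.sum_comm]
        exact Finset.sum_congr rfl fun m _ => Finset.sum_congr rfl fun i _ => by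
          simp only [Function.comp_apply]; ring
      have h5 : ∀ i n, ∫ x, f (B i x) ∂(c n i) = (n + 1 : ℝ)⁻¹ *
          ∑ m ∈ Finset.range (n + 1), ∫ x, (f ∘ B i) x ∂(e m i) := fun i n =>
        hci (f ∘ B i) (hf.comp (hB i)) n i
      simp only [h5]
      rw [h4, ← mul_sub, ← Finset.sum_sub_distrib,
        Finset.sum_range_sub (fun m => ∫ x, f x ∂(e m j))]
    have h4 : ∀ m, |∫ x, f x ∂(e m j)| ≤ ‖f‖ := fun m => by
      have := norm_integral_le_of_norm_le_const (μ := e m j) (ae_of_all _ f.norm_coe_le_norm)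
      simpa using this
    have h5 : Tendsto (fun n : ℕ => (n + 1 : ℝ)⁻¹ *
        (∫ x, f x ∂(e (n + 1) j) - ∫ x, f x ∂(e 0 j))) atTop (𝓝 0) := by
      have h6 : Tendsto (fun n : ℕ => (n + 1 : ℝ)⁻¹ * (2 * ‖f‖)) atTop (𝓝 0) := by
        have := (tendsto_one_div_add_atTop_nhds_zero_nat (𝕜 := ℝ)).mul_const (2 * ‖f‖)
        simpa using this
      refine squeeze_zero_norm (fun n => ?_) h6
      rw [norm_mul, Real.norm_of_nonneg (by positivity : (0 : ℝ) ≤ (n + 1 : ℝ)⁻¹)]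
      refine mul_le_mul_of_nonneg_left ?_ (by positivity)
      have h7 := abs_le.1 (h4 (n + 1))
      have h8 := abs_le.1 (h4 0)
      exact abs_le.2 ⟨by linarith [h7.1, h8.2], by linarith [h7.2, h8.1]⟩
    have h6 := h2.sub h1
    simp only [h3] at h6
    have h7 := tendsto_nhds_unique h6 (h5.mono_left hU)
    linarith
  refine ⟨fun j => ν j, fun j => inferInstance, fun j s hs => ?_, fun f hf hw j => ?_⟩
  · change (ν j : Measure X).real s = _
    rw [hstat j, measureReal_def]
    rw [avgMeasure, Measure.finsetSum_apply, ENNReal.toReal_sum]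
    · refine Finset.sum_congr rfl fun i _ => ?_
      rw [Measure.smul_apply, Measure.map_apply (hB i).measurable hs, smul_eq_mul,
        ENNReal.toReal_mul, ENNReal.toReal_ofReal (hP i j), measureReal_def]
    · intro i _
      rw [Measure.smul_apply, Measure.map_apply (hB i).measurable hs, smul_eq_mul]
      exact ENNReal.mul_ne_top ENNReal.ofReal_ne_top (measure_ne_top _ _)
  -- The test function is generalised because pulling back by `B i` prepends the letter `i` to every
  -- word.
  · have h0 : ∀ m, ∀ g : X → ℝ, Continuous g → (∀ w : List (Fin k), g (wordMap B w b) = 0) →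
        ∀ j, ∫ x, g x ∂(e m j) = 0 := by
      intro m
      induction m with
      | zero =>
        intro g hg hw j
        change ∫ x, g x ∂(Measure.dirac b) = 0
        rw [integral_dirac' _ _ hg.stronglyMeasurable]
        exact hw []
      | succ m ih =>
        intro g hg hw j
        rw [he1, integral_avgMeasure hP hB (hep m) hg]
        refine Finset.sum_eq_zero fun i _ => ?_
        rw [ih (fun x => g (B i x)) (hg.comp (hB i)) (fun w => hw (i :: w)) i, mul_zero]
    have h1 := hνi f hf j
    simp only [hci f hf, h0 _ f hf hw, Finset.sum_const_zero, mul_zero] at h1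
    exact (tendsto_nhds_unique h1 tendsto_const_nhds)

end Stationary

/-! ### Stationary measures on the unit sphere -/

section Sphere

variable {E : Type*} [NormedAddCommGroup E] [InnerProductSpace ℝ E]

/-- The action `u ↦ L u / ‖L u‖` of an injective linear map on the unit sphere. -/
noncomputable def sphereMap (L : E →L[ℝ] E) (hL : Function.Injective L)
    (u : Metric.sphere (0 : E) 1) : Metric.sphere (0 : E) 1 :=
  ⟨‖L u‖⁻¹ • L u, by
    have h : L u ≠ 0 := (map_ne_zero_iff L hL).2 (ne_zero_of_mem_unit_sphere u)
    simp [norm_smul, h]⟩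

theorem coe_sphereMap (L : E →L[ℝ] E) (hL : Function.Injective L) (u : Metric.sphere (0 : E) 1) :
    (sphereMap L hL u : E) = ‖L u‖⁻¹ • L u := rfl

theorem inv_norm_apply_ne_zero {L : E →L[ℝ] E} (hL : Function.Injective L)
    (u : Metric.sphere (0 : E) 1) : ‖L u‖⁻¹ ≠ 0 :=
  inv_ne_zero (norm_ne_zero_iff.2 ((map_ne_zero_iff L hL).2 (ne_zero_of_mem_unit_sphere u)))

theorem continuous_sphereMap (L : E →L[ℝ] E) (hL : Function.Injective L) :
    Continuous (sphereMap L hL) := by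
  refine Continuous.subtype_mk (Continuous.smul (Continuous.inv₀ (by fun_prop) fun u => ?_)
    (by fun_prop)) _
  exact fun h => inv_norm_apply_ne_zero hL u (inv_eq_zero.2 h)

/-- The points of the unit sphere that lie in the subspace `V`. -/
def sphereInter (V : Submodule ℝ E) : Set (Metric.sphere (0 : E) 1) := {u | (u : E) ∈ V}

theorem sphereMap_preimage_sphereInter (L : E →L[ℝ] E) (hL : Function.Injective L)
    (V : Submodule ℝ E) :
    sphereMap L hL ⁻¹' sphereInter V = sphereInter (V.comap (L : E →ₗ[ℝ] E)) := by
  ext u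
  simp only [sphereInter, Set.mem_preimage, Set.mem_ofPred_eq, coe_sphereMap, Submodule.mem_comap]
  exact V.smul_mem_iff (inv_norm_apply_ne_zero hL u)

variable [FiniteDimensional ℝ E]

theorem bijective_of_injective {L : E →L[ℝ] E} (hL : Function.Injective L) :
    Function.Bijective L :=
  ⟨hL, LinearMap.injective_iff_surjective (f := (L : E →ₗ[ℝ] E)).1 hL⟩

theorem adjoint_injective {L : E →L[ℝ] E} (hL : Function.Injective L) :
    Function.Injective (ContinuousLinearMap.adjoint L) := by
  refine (injective_iff_map_eq_zero _).2 fun v hv => ?_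
  obtain ⟨u, rfl⟩ := (bijective_of_injective hL).2 v
  have : inner ℝ u (ContinuousLinearMap.adjoint L (L u)) = 0 := by rw [hv, inner_zero_right]
  rw [ContinuousLinearMap.adjoint_inner_right] at this
  exact inner_self_eq_zero.1 this

/-- Stationarity for the adjoint action permutes subspaces by adjoint preimages, whereas
irreducibility concerns the maps themselves; orthogonal complements translate one into the other. -/
theorem map_orthogonal_eq {L : E →L[ℝ] E} (hL : Function.Injective L) (V : Submodule ℝ E) :
    L '' (Vᗮ : Set E)
      = (V.comap (ContinuousLinearMap.adjoint L : E →ₗ[ℝ] E))ᗮ := by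
  ext w
  obtain ⟨u, rfl⟩ := (bijective_of_injective hL).2 w
  rw [hL.mem_set_image]
  simp only [SetLike.mem_coe, Submodule.mem_orthogonal', Submodule.mem_comap,
    ContinuousLinearMap.coe_coe]
  constructor
  · intro h v hv
    rw [← ContinuousLinearMap.adjoint_inner_right]
    exact h _ hv
  · intro h v hv
    obtain ⟨v, rfl⟩ := (bijective_of_injective (adjoint_injective hL)).2 v
    rw [ContinuousLinearMap.adjoint_inner_right]
    exact h v hv

theorem finrank_comap_of_injective {L : E →L[ℝ] E} (hL : Function.Injective L)
    (V : Submodule ℝ E) :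
    Module.finrank ℝ (V.comap (L : E →ₗ[ℝ] E)) = Module.finrank ℝ V := by
  have h := LinearEquiv.finrank_map_eq
    (LinearEquiv.ofBijective (L : E →ₗ[ℝ] E) (bijective_of_injective hL))
    (V.comap (L : E →ₗ[ℝ] E))
  rw [← h]
  exact congrArg (fun W : Submodule ℝ E => Module.finrank ℝ W)
    (Submodule.map_comap_eq_of_surjective (bijective_of_injective hL).2 V)

variable [MeasurableSpace E] [BorelSpace E]

theorem measurableSet_sphereInter (V : Submodule ℝ E) : MeasurableSet (sphereInter V) :=
  (V.closed_of_finiteDimensional.preimage continuous_subtype_val).measurableSet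

/-- Subspaces of the same dimension all of whose proper subspaces are null carry total mass at
most one. -/
theorem finite_setOf_le_measureReal {μ : Measure (Metric.sphere (0 : E) 1)} [IsProbabilityMeasure μ]
    {l : ℕ} (hnull : ∀ V : Submodule ℝ E, Module.finrank ℝ V < l → μ.real (sphereInter V) = 0)
    {ε : ℝ} (hε : 0 < ε) :
    {V : Submodule ℝ E | Module.finrank ℝ V = l ∧ ε ≤ μ.real (sphereInter V)}.Finite := by
  by_contra hinf
  obtain ⟨n, hn⟩ := exists_nat_gt (1 / ε)
  obtain ⟨t, hts, htn⟩ := Set.Infinite.exists_subset_card_eq hinf n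
  have h1 : μ.real (⋃ V ∈ t, sphereInter V) = ∑ V ∈ t, μ.real (sphereInter V) := by
    refine measureReal_biUnion_finset₀ (fun V hV W hW hVW => ?_)
      fun V _ => (measurableSet_sphereInter V).nullMeasurableSet
    -- Distinct subspaces of dimension `l` meet in smaller dimension, so they are disjoint up to
    -- null sets and their masses add.
    have h2 : Module.finrank ℝ (V ⊓ W : Submodule ℝ E) < l := by
      rw [← (hts hV).1]
      refine Submodule.finrank_lt_finrank_of_lt (lt_of_le_of_ne inf_le_left fun h => hVW ?_)
      refine Submodule.eq_of_le_of_finrank_eq (inf_eq_left.1 h) ?_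
      rw [(hts hV).1, (hts hW).1]
    exact (measureReal_eq_zero_iff).1 (hnull _ h2)
  have h2 : (n : ℝ) * ε ≤ ∑ V ∈ t, μ.real (sphereInter V) := by
    rw [← htn, ← nsmul_eq_mul]
    exact Finset.card_nsmul_le_sum _ _ _ fun V hV => (hts hV).2
  have h3 : μ.real (⋃ V ∈ t, sphereInter V) ≤ 1 := measureReal_le_one
  rw [div_lt_iff₀ hε] at hn
  linarith

variable {k : ℕ}

/-- Stationary measures of the adjoint action do not charge proper subspaces. -/
theorem measureReal_sphereInter_eq_zero {P : Fin k → Fin k → ℝ} (hP : ∀ i j, 0 < P i j)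
    (hP1 : ∀ j, ∑ i, P i j = 1) {A : Fin k → E →L[ℝ] E} (hA : ∀ i, Function.Injective (A i))
    (hirr : ¬ ∃ F : Finset (Submodule ℝ E), F.Nonempty ∧ (∀ V ∈ F, V ≠ ⊥ ∧ V ≠ ⊤) ∧
      ∀ i, A i '' (⋃ V ∈ F, (V : Set E)) = ⋃ V ∈ F, (V : Set E))
    {ν : Fin k → Measure (Metric.sphere (0 : E) 1)} (hν : ∀ j, IsProbabilityMeasure (ν j))
    (hstat : ∀ j s, MeasurableSet s → (ν j).real s =
      ∑ i, P i j * (ν i).real (sphereMap _ (adjoint_injective (hA i)) ⁻¹' s))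
    (V : Submodule ℝ E) (hV : V ≠ ⊤) (j : Fin k) : (ν j).real (sphereInter V) = 0 := by
  classical
  by_contra hne
  -- Furstenberg's argument: take the least dimension `l` of a charged proper subspace, over all
  -- letters, and then the largest mass `m` in that dimension.
  set p : ℕ → Prop := fun l => ∃ (j : Fin k) (V : Submodule ℝ E), Module.finrank ℝ V = l ∧
    V ≠ ⊤ ∧ (ν j).real (sphereInter V) ≠ 0 with hp
  have hex : ∃ l, p l := ⟨_, j, V, rfl, hV, hne⟩
  set l := Nat.find hex with hl
  obtain ⟨j₀, V₀, hV₀l, hV₀, hV₀0⟩ := Nat.find_spec hex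
  rw [← hl] at hV₀l
  have hlt : l < Module.finrank ℝ E := by
    rw [← hV₀l]; exact Submodule.finrank_lt hV₀
  have htop : ∀ V : Submodule ℝ E, Module.finrank ℝ V ≤ l → V ≠ ⊤ := by
    rintro V hV rfl
    rw [finrank_top] at hV
    omega
  have hnull : ∀ j (V : Submodule ℝ E), Module.finrank ℝ V < l → (ν j).real (sphereInter V) = 0 := by
    intro j V hV
    by_contra h
    exact Nat.find_min hex hV ⟨j, V, rfl, htop V hV.le, h⟩
  have hε : 0 < (ν j₀).real (sphereInter V₀) := lt_of_le_of_ne measureReal_nonneg (Ne.symm hV₀0)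
  set ε := (ν j₀).real (sphereInter V₀)
  have hfin : ∀ ε > 0, ∀ j, {V : Submodule ℝ E | Module.finrank ℝ V = l ∧
      ε ≤ (ν j).real (sphereInter V)}.Finite := fun ε hε j =>
    finite_setOf_le_measureReal (hnull j) hε
  obtain ⟨⟨j₁, V₁⟩, h1, hmax⟩ := Set.exists_max_image
    (⋃ j : Fin k, (fun V => (j, V)) '' {V : Submodule ℝ E | Module.finrank ℝ V = l ∧
      ε ≤ (ν j).real (sphereInter V)}) (fun q => (ν q.1).real (sphereInter q.2))
    (Set.finite_iUnion fun j => (hfin ε hε j).image _)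
    ⟨(j₀, V₀), Set.mem_iUnion.2 ⟨j₀, V₀, ⟨hV₀l, le_rfl⟩, rfl⟩⟩
  have h1' : Module.finrank ℝ V₁ = l ∧ ε ≤ (ν j₁).real (sphereInter V₁) := by
    obtain ⟨j, V, h, he⟩ := Set.mem_iUnion.1 h1
    obtain ⟨rfl, rfl⟩ := Prod.mk.inj he
    exact h
  set m := (ν j₁).real (sphereInter V₁) with hm
  have hm0 : 0 < m := hε.trans_le h1'.2
  have hle : ∀ j (V : Submodule ℝ E), Module.finrank ℝ V = l → (ν j).real (sphereInter V) ≤ m := by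
    intro j V hV
    by_cases h : ε ≤ (ν j).real (sphereInter V)
    · exact hmax (j, V) (Set.mem_iUnion.2 ⟨j, V, ⟨hV, h⟩, rfl⟩)
    · exact (not_le.1 h).le.trans h1'.2
  set F : Fin k → Set (Submodule ℝ E) := fun j =>
    {V | Module.finrank ℝ V = l ∧ m ≤ (ν j).real (sphereInter V)} with hF
  have hFfin : ∀ j, (F j).Finite := fun j => hfin m hm0 j
  set φ : Fin k → Submodule ℝ E → Submodule ℝ E := fun i V =>
    V.comap (ContinuousLinearMap.adjoint (A i) : E →ₗ[ℝ] E) with hφ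
  have hφinj : ∀ i, Function.Injective (φ i) := fun i =>
    Submodule.comap_injective_of_surjective (bijective_of_injective (adjoint_injective (hA i))).2
  -- By stationarity a mass `m` is an average of masses at most `m`; as all weights are positive,
  -- every one of them equals `m`.
  have hmaps : ∀ i j, φ i '' F j ⊆ F i := by
    rintro i j _ ⟨V, ⟨hVl, hVm⟩, rfl⟩
    have hdim : ∀ i, Module.finrank ℝ (φ i V) = l := fun i => by
      rw [hφ]; exact (finrank_comap_of_injective (adjoint_injective (hA i)) V).trans hVl
    refine ⟨hdim i, ?_⟩
    rw [hstat j _ (measurableSet_sphereInter V)] at hVm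
    simp only [sphereMap_preimage_sphereInter] at hVm
    by_contra hlt
    have h2 : ∑ i, P i j * (ν i).real (sphereInter (φ i V)) < ∑ i, P i j * m :=
      Finset.sum_lt_sum (fun i _ => mul_le_mul_of_nonneg_left (hle i _ (hdim i)) (hP i j).le)
        ⟨i, Finset.mem_univ i, mul_lt_mul_of_pos_left (not_le.1 hlt) (hP i j)⟩
    rw [← Finset.sum_mul, hP1, one_mul] at h2
    exact absurd hVm (not_le.2 h2)
  -- The inclusions go both ways between any two letters, so these finite sets have equal size. The
  -- inclusions are then equalities, and injectivity of `φ i` makes `F` independent of the letter.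
  have hcard : ∀ i j, (F j).ncard ≤ (F i).ncard := fun i j => by
    rw [← Set.ncard_image_of_injective (F j) (hφinj i)]
    exact Set.ncard_le_ncard (hmaps i j) (hFfin i)
  have himg : ∀ i j, φ i '' F j = F i := fun i j => by
    refine Set.eq_of_subset_of_ncard_le (hmaps i j) ?_ (hFfin i)
    rw [Set.ncard_image_of_injective (F j) (hφinj i)]
    exact hcard j i
  have hFeq : ∀ i, F i = F j₁ := fun i =>
    (hφinj i).image_injective ((himg i i).trans (himg i j₁).symm)
  refine hirr ⟨(hFfin j₁).toFinset.image Submodule.orthogonal, ?_, ?_, fun i => ?_⟩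
  · exact ⟨V₁ᗮ, Finset.mem_image_of_mem _ ((hFfin j₁).mem_toFinset.2 ⟨h1'.1, le_rfl⟩)⟩
  · intro W hW
    obtain ⟨V, hV, rfl⟩ := Finset.mem_image.1 hW
    obtain ⟨hVl, hVm⟩ := (hFfin j₁).mem_toFinset.1 hV
    -- The zero subspace has no unit vectors, so it cannot carry the positive mass `m`.
    refine ⟨fun h => htop V hVl.le ((Submodule.orthogonal_eq_bot_iff).1 h), fun h => ?_⟩
    rw [Submodule.orthogonal_eq_top_iff] at h
    have : sphereInter V = ∅ := by
      ext u
      simp only [sphereInter, h, Submodule.mem_bot, Set.mem_ofPred_eq, Set.mem_empty_iff_false,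
        iff_false]
      exact ne_zero_of_mem_unit_sphere u
    rw [this, measureReal_empty] at hVm
    linarith
  · have hU : ⋃ V ∈ (hFfin j₁).toFinset.image Submodule.orthogonal, (V : Set E)
        = ⋃ V ∈ F j₁, (Vᗮ : Set E) := by
      ext u; simp
    rw [hU, Set.image_iUnion₂]
    simp only [map_orthogonal_eq (hA i)]
    conv_rhs => rw [← hFeq i, ← himg i j₁, Set.biUnion_image]

/-! ### Mass near hyperplanes -/

/-- The points of the unit sphere at distance at most `r` from the hyperplane `xᗮ`. -/
def band (x : E) (r : ℝ) : Set (Metric.sphere (0 : E) 1) := {u | |inner ℝ x (u : E)| ≤ r}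

omit [FiniteDimensional ℝ E] [MeasurableSpace E] [BorelSpace E] in
theorem mem_band {x : E} {r : ℝ} {u : Metric.sphere (0 : E) 1} :
    u ∈ band x r ↔ |inner ℝ x (u : E)| ≤ r := Iff.rfl

omit [FiniteDimensional ℝ E] [MeasurableSpace E] [BorelSpace E] in
theorem band_mono (x : E) {r s : ℝ} (h : r ≤ s) : band x r ⊆ band x s :=
  fun _ hu => mem_band.2 ((mem_band.1 hu).trans h)

/-- Stationary measures of the adjoint action give uniformly small mass to small neighbourhoods of
hyperplanes. -/
theorem exists_forall_measureReal_abs_inner_le {ν : Fin k → Measure (Metric.sphere (0 : E) 1)}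
    (hν : ∀ j, IsProbabilityMeasure (ν j))
    (hnull : ∀ j (V : Submodule ℝ E), V ≠ ⊤ → (ν j).real (sphereInter V) = 0) {η : ℝ}
    (hη : 0 < η) :
    ∃ r : ℝ, 0 < r ∧ r ≤ 1 ∧ ∀ x : E, ‖x‖ = 1 → ∀ j,
      (ν j).real (band x r) ≤ η := by
  -- The radius is doubled so that the bound survives moving `x` by less than `r`; compactness of
  -- the sphere then makes it uniform.
  have hloc : ∀ x : E, ‖x‖ = 1 → ∃ r : ℝ, 0 < r ∧ ∀ j,
      (ν j).real (band x (2 * r)) ≤ η := by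
    intro x hx
    have hx0 : x ≠ 0 := by rintro rfl; simp at hx
    set s : ℕ → Set (Metric.sphere (0 : E) 1) := fun n =>
      band x (2 * (1 / ((n : ℝ) + 1)))
    have hsm : ∀ n, MeasurableSet (s n) := fun n =>
      (isClosed_le (by fun_prop) continuous_const).measurableSet
    have hanti : Antitone s := fun m n hmn =>
      band_mono x (mul_le_mul_of_nonneg_left (one_div_le_one_div_of_le (by positivity)
        (by simpa using hmn)) (by norm_num))
    have hinter : ⋂ n, s n = sphereInter ((ℝ ∙ x)ᗮ) := by
      ext u
      simp only [s, mem_band, sphereInter, Set.mem_iInter, Set.mem_ofPred_eq,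
        Submodule.mem_orthogonal_singleton_iff_inner_right]
      constructor
      · intro h
        have h1 := (tendsto_one_div_add_atTop_nhds_zero_nat (𝕜 := ℝ)).const_mul 2
        rw [mul_zero] at h1
        exact abs_nonpos_iff.1 (ge_of_tendsto' h1 h)
      · intro h n
        rw [h, abs_zero]
        positivity
    have htop : (ℝ ∙ x)ᗮ ≠ ⊤ := by
      rw [Ne, Submodule.orthogonal_eq_top_iff, Submodule.span_singleton_eq_bot]
      exact hx0
    have hev : ∀ j, ∀ᶠ n in atTop, (ν j).real (s n) ≤ η := by
      intro j
      have h1 : Tendsto (fun n => ν j (s n)) atTop (𝓝 (ν j (⋂ n, s n))) :=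
        tendsto_measure_iInter_atTop (fun n => (hsm n).nullMeasurableSet) hanti
          ⟨0, measure_ne_top _ _⟩
      have h2 := (ENNReal.tendsto_toReal (measure_ne_top (ν j) _)).comp h1
      change Tendsto (fun n => (ν j).real (s n)) atTop (𝓝 ((ν j).real (⋂ n, s n))) at h2
      rw [hinter, hnull j _ htop] at h2
      exact h2.eventually_le_const hη
    obtain ⟨n, hn⟩ := (eventually_all.2 hev).exists
    exact ⟨1 / ((n : ℝ) + 1), by positivity, hn⟩
  have hcpt : ∃ r : ℝ, 0 < r ∧ ∀ x ∈ Metric.sphere (0 : E) 1, ∀ j,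
      (ν j).real (band x r) ≤ η := by
    refine (isCompact_sphere (0 : E) 1).induction_on
      (p := fun t => ∃ r : ℝ, 0 < r ∧ ∀ x ∈ t, ∀ j,
        (ν j).real (band x r) ≤ η) ?_ ?_ ?_ ?_
    · exact ⟨1, one_pos, by simp⟩
    · rintro s t hst ⟨r, hr, h⟩
      exact ⟨r, hr, fun x hx => h x (hst hx)⟩
    · rintro s t ⟨r, hr, h⟩ ⟨r', hr', h'⟩
      refine ⟨min r r', lt_min hr hr', fun x hx j => ?_⟩
      rcases hx with hx | hx
      · exact (measureReal_mono (band_mono x (min_le_left _ _))).trans (h x hx j)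
      · exact (measureReal_mono (band_mono x (min_le_right _ _))).trans (h' x hx j)
    · intro x hx
      obtain ⟨r, hr, h⟩ := hloc x (by simpa using hx)
      refine ⟨Metric.ball x r, mem_nhdsWithin_of_mem_nhds (Metric.ball_mem_nhds x hr), r, hr,
        fun y hy j => le_trans (measureReal_mono fun u hu => ?_) (h j)⟩
      rw [mem_band] at hu ⊢
      have h1 : inner ℝ x (u : E) = inner ℝ y (u : E) + inner ℝ (x - y) (u : E) := by
        rw [← inner_add_left]; congr 1; abel
      have h2 : |inner ℝ (x - y) (u : E)| ≤ r := by
        refine (abs_real_inner_le_norm _ _).trans ?_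
        rw [norm_eq_of_mem_sphere u, mul_one, ← dist_eq_norm, dist_comm]
        exact (Metric.mem_ball.1 hy).le
      rw [h1]
      exact (abs_add_le _ _).trans (by linarith)
  obtain ⟨r, hr, h⟩ := hcpt
  exact ⟨min r 1, lt_min hr one_pos, min_le_right _ _, fun x hx j =>
    (measureReal_mono (band_mono x (min_le_left _ _))).trans
      (h x (by simpa using hx) j)⟩

/-- The product of the maps `A i` along a word; the last letter acts first. -/
noncomputable def wordProd (A : Fin k → E →L[ℝ] E) (w : List (Fin k)) : E →L[ℝ] E :=
  (w.map A).prod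

omit [FiniteDimensional ℝ E] [MeasurableSpace E] [BorelSpace E] in
@[simp] theorem wordProd_nil (A : Fin k → E →L[ℝ] E) : wordProd A [] = 1 := rfl

omit [FiniteDimensional ℝ E] [MeasurableSpace E] [BorelSpace E] in
@[simp] theorem wordProd_cons (A : Fin k → E →L[ℝ] E) (i : Fin k) (w : List (Fin k)) :
    wordProd A (i :: w) = A i * wordProd A w := by simp [wordProd]

omit [FiniteDimensional ℝ E] [MeasurableSpace E] [BorelSpace E] in
theorem wordProd_append (A : Fin k → E →L[ℝ] E) (v w : List (Fin k)) :
    wordProd A (v ++ w) = wordProd A v * wordProd A w := by simp [wordProd]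

-- Taking adjoints reverses the order of a product, and `c` collects the normalisations. Vanishing
-- of `inner` on the adjoint orbit of `b` thus becomes a statement about products applied to `x`.
omit [MeasurableSpace E] [BorelSpace E] in
theorem exists_inner_wordMap_eq {A : Fin k → E →L[ℝ] E} (hA : ∀ i, Function.Injective (A i))
    (b : Metric.sphere (0 : E) 1) (w : List (Fin k)) :
    ∃ c : ℝ, ∀ x : E, inner ℝ x
      ((wordMap (fun i => sphereMap _ (adjoint_injective (hA i))) w b :
        Metric.sphere (0 : E) 1) : E)
      = c * inner ℝ (wordProd A w.reverse x) (b : E) := by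
  induction w with
  | nil => exact ⟨1, fun x => by simp⟩
  | cons i w ih =>
    obtain ⟨c, hc⟩ := ih
    refine ⟨‖ContinuousLinearMap.adjoint (A i)
      (wordMap (fun i => sphereMap _ (adjoint_injective (hA i))) w b :
        Metric.sphere (0 : E) 1)‖⁻¹ * c, fun x => ?_⟩
    rw [wordMap_cons, coe_sphereMap, inner_smul_right, ContinuousLinearMap.adjoint_inner_right,
      hc, List.reverse_cons, wordProd_append, ← mul_assoc]
    simp

/-- Under strong irreducibility, any two non-zero vectors can be moved simultaneously off a given
hyperplane. -/
theorem exists_wordProd_inner_ne_zero [NeZero k] {A : Fin k → E →L[ℝ] E}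
    (hA : ∀ i, Function.Injective (A i))
    (hirr : ¬ ∃ F : Finset (Submodule ℝ E), F.Nonempty ∧ (∀ V ∈ F, V ≠ ⊥ ∧ V ≠ ⊤) ∧
      ∀ i, A i '' (⋃ V ∈ F, (V : Set E)) = ⋃ V ∈ F, (V : Set E))
    {x y b : E} (hx : x ≠ 0) (hy : y ≠ 0) (hb : b ≠ 0) :
    ∃ w : List (Fin k), inner ℝ (wordProd A w x) b ≠ 0 ∧ inner ℝ (wordProd A w y) b ≠ 0 := by
  by_contra! hcon
  have hk : (0 : ℝ) < k := by exact_mod_cast Nat.pos_of_ne_zero (NeZero.ne k)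
  have hP1 : ∀ _ : Fin k, ∑ _ : Fin k, (1 / (k : ℝ)) = 1 := fun j => by
    simp [hk.ne']
  have hP : ∀ _ _ : Fin k, 0 < 1 / (k : ℝ) := fun _ _ => by positivity
  -- Otherwise the product of the two functionals vanishes on the whole adjoint orbit of `b`, hence
  -- has integral zero for a stationary measure built from that orbit; but such a measure charges
  -- neither hyperplane. Any positive transition matrix would do, and the uniform one is taken.
  set b' : Metric.sphere (0 : E) 1 := ⟨‖b‖⁻¹ • b, by simp [norm_smul, hb]⟩ with hb'
  obtain ⟨ν, hν, hstat, hzero⟩ := exists_stationary (P := fun _ _ => 1 / (k : ℝ))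
    (fun i j => (hP i j).le) hP1
    (fun i => continuous_sphereMap _ (adjoint_injective (hA i))) b'
  set j : Fin k := 0
  have hnull := fun V hV =>
    measureReal_sphereInter_eq_zero hP hP1 hA hirr hν hstat V hV j
  have hcont : Continuous fun u : Metric.sphere (0 : E) 1 =>
      |inner ℝ x (u : E)| * |inner ℝ y (u : E)| := by fun_prop
  have h0 := hzero _ hcont (fun w => by
    obtain ⟨c, hc⟩ := exists_inner_wordMap_eq hA b' w
    rw [hc, hc, hb', inner_smul_right, inner_smul_right]
    by_cases h : inner ℝ (wordProd A w.reverse x) b = 0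
    · simp [h]
    · simp [hcon _ h]) j
  have hint : Integrable (fun u : Metric.sphere (0 : E) 1 =>
      |inner ℝ x (u : E)| * |inner ℝ y (u : E)|) (ν j) :=
    (BoundedContinuousFunction.mkOfCompact ⟨_, hcont⟩).integrable (ν j)
  rw [integral_eq_zero_iff_of_nonneg (fun u => by positivity) hint] at h0
  have htop : ∀ z : E, z ≠ 0 → (ℝ ∙ z)ᗮ ≠ ⊤ := fun z hz => by
    rw [Ne, Submodule.orthogonal_eq_top_iff, Submodule.span_singleton_eq_bot]
    exact hz
  have hae : ∀ z : E, z ≠ 0 → ∀ᵐ u : Metric.sphere (0 : E) 1 ∂(ν j), inner ℝ z (u : E) ≠ 0 :=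
    fun z hz => by
    have := (measureReal_eq_zero_iff).1 (hnull _ (htop z hz))
    rw [ae_iff]
    convert this using 2
    ext u
    simp [sphereInter, Submodule.mem_orthogonal_singleton_iff_inner_right]
  have := (h0.and ((hae x hx).and (hae y hy))).exists
  obtain ⟨u, h1, h2, h3⟩ := this
  simp [h2, h3] at h1

end Sphere

/-! ### Areas of parallelograms and linear maps -/

section Area

variable {E : Type*} [NormedAddCommGroup E] [InnerProductSpace ℝ E]

/-- The area of the parallelogram spanned by `v` and `w`. -/
noncomputable def area (v w : E) : ℝ := √(‖v‖ ^ 2 * ‖w‖ ^ 2 - inner ℝ v w ^ 2)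

theorem area_comm (v w : E) : area v w = area w v := by
  rw [area, area, real_inner_comm, mul_comm]

theorem area_nonneg (v w : E) : 0 ≤ area v w := Real.sqrt_nonneg _

theorem area_zero_left (w : E) : area (0 : E) w = 0 := by simp [area]

/-- Base times height; this reduces subadditivity of `area` to the triangle inequality. -/
theorem area_eq_norm_mul_norm {v : E} (hv : v ≠ 0) (w : E) :
    area v w = ‖v‖ * ‖w - (inner ℝ v w / ‖v‖ ^ 2) • v‖ := by
  have hv0 : ‖v‖ ≠ 0 := norm_ne_zero_iff.2 hv
  rw [area, ← Real.sqrt_sq (by positivity : 0 ≤ ‖v‖ * ‖w - (inner ℝ v w / ‖v‖ ^ 2) • v‖)]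
  congr 1
  rw [mul_pow, norm_sub_sq_real, norm_smul, inner_smul_right, Real.norm_eq_abs, mul_pow, sq_abs,
    real_inner_comm v w]
  field_simp
  ring

theorem area_le_norm_mul_norm (v w : E) : area v w ≤ ‖v‖ * ‖w‖ := by
  refine Real.sqrt_le_iff.2 ⟨by positivity, ?_⟩
  nlinarith [sq_nonneg (inner ℝ v w)]

theorem area_add_smul (v w : E) (c : ℝ) : area v (w + c • v) = area v w := by
  rw [area, area]
  congr 1
  rw [norm_add_sq_real, inner_add_right, inner_smul_right, inner_smul_right, norm_smul,
    real_inner_self_eq_norm_sq, real_inner_comm w v, Real.norm_eq_abs, mul_pow, sq_abs]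
  ring

theorem area_add_right_le (v w w' : E) : area v (w + w') ≤ area v w + area v w' := by
  rcases eq_or_ne v 0 with rfl | hv
  · simp [area_zero_left]
  · rw [area_eq_norm_mul_norm hv, area_eq_norm_mul_norm hv, area_eq_norm_mul_norm hv, ← mul_add]
    refine mul_le_mul_of_nonneg_left ?_ (norm_nonneg v)
    refine le_trans (le_of_eq ?_) (norm_add_le _ _)
    rw [inner_add_right, add_div, add_smul]
    congr 1
    abel

/-- A bound for the areas of images of parallelograms by the product of the sides improves to a
bound by the area. -/
theorem area_map_le {L : E →L[ℝ] E} {C : ℝ} (h : ∀ v w, area (L v) (L w) ≤ C * (‖v‖ * ‖w‖))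
    (v w : E) : area (L v) (L w) ≤ C * area v w := by
  rcases eq_or_ne v 0 with rfl | hv
  · simp [area_zero_left]
  -- Shearing `w` to its component orthogonal to `v` changes neither area, and the product of the
  -- sides becomes the area.
  · rw [area_eq_norm_mul_norm hv w]
    refine le_trans (le_of_eq ?_) (h _ _)
    rw [map_sub, map_smul, sub_eq_add_neg, ← neg_smul, area_add_smul]

theorem area_map_le_opNorm_sq (L : E →L[ℝ] E) (v w : E) :
    area (L v) (L w) ≤ ‖L‖ ^ 2 * area v w := by
  refine area_map_le (fun v w => (area_le_norm_mul_norm _ _).trans ?_) v w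
  calc ‖L v‖ * ‖L w‖ ≤ (‖L‖ * ‖v‖) * (‖L‖ * ‖w‖) := by gcongr <;> exact L.le_opNorm _
    _ = _ := by ring

/-- Linear maps close to a map of rank one contract areas. -/
theorem area_map_le_of_near {B R : E →L[ℝ] E} (hR : ∀ v w, area (R v) (R w) = 0) (v w : E) :
    area (B v) (B w) ≤ (‖B‖ + ‖R‖) * ‖B - R‖ * area v w := by
  refine area_map_le (fun v w => ?_) v w
  -- `B` is replaced by `R` in one side at a time; the remaining term `area (R v) (R w)` vanishes.
  have h1 : area (B v) (B w) ≤ area (B v) (R w) + area (B v) ((B - R) w) := by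
    refine le_trans (le_of_eq ?_) (area_add_right_le _ _ _)
    simp
  have h2 : area (R w) (B v) ≤ area (R w) (R v) + area (R w) ((B - R) v) := by
    refine le_trans (le_of_eq ?_) (area_add_right_le _ _ _)
    simp
  rw [area_comm, hR, zero_add] at h2
  have h3 : area (B v) ((B - R) w) ≤ (‖B‖ * ‖v‖) * (‖B - R‖ * ‖w‖) :=
    (area_le_norm_mul_norm _ _).trans (by gcongr <;> exact ContinuousLinearMap.le_opNorm _ _)
  have h4 : area (R w) ((B - R) v) ≤ (‖R‖ * ‖w‖) * (‖B - R‖ * ‖v‖) :=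
    (area_le_norm_mul_norm _ _).trans (by gcongr <;> exact ContinuousLinearMap.le_opNorm _ _)
  calc _ ≤ (‖R‖ * ‖w‖) * (‖B - R‖ * ‖v‖) + (‖B‖ * ‖v‖) * (‖B - R‖ * ‖w‖) := by linarith
    _ = _ := by ring

theorem area_comp_le {L L' : E →L[ℝ] E} {C : ℝ} (hC : 0 ≤ C)
    (h : ∀ v w, area (L v) (L w) ≤ C * area v w) (v w : E) :
    area ((L * L') v) ((L * L') w) ≤ C * ‖L'‖ ^ 2 * area v w := by
  refine (h _ _).trans ?_
  rw [mul_assoc]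
  exact mul_le_mul_of_nonneg_left (area_map_le_opNorm_sq L' v w) hC

theorem area_smul_map (c : ℝ) (L : E →L[ℝ] E) (v w : E) :
    area ((c • L) v) ((c • L) w) = c ^ 2 * area (L v) (L w) := by
  have : ∀ a b : E, area (c • a) (c • b) = c ^ 2 * area a b := fun a b => by
    rw [area, area, ← Real.sqrt_sq (sq_nonneg c), ← Real.sqrt_mul (sq_nonneg _)]
    congr 1
    rw [norm_smul, norm_smul, real_inner_smul_left, real_inner_smul_right, mul_pow, mul_pow,
      Real.norm_eq_abs, sq_abs]
    ring
  exact this _ _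

variable [FiniteDimensional ℝ E]

/-! ### Dual bands and expansion -/

/-- The points `u` of the unit sphere for which `⟪L v, u⟫` is small compared with the adjoint image
of `u`. -/
noncomputable def dualBand (L : E →L[ℝ] E) (v : E) (r : ℝ) : Set (Metric.sphere (0 : E) 1) :=
  {u | |inner ℝ (L v) (u : E)| ≤ r * ‖ContinuousLinearMap.adjoint L u‖}

theorem mem_dualBand {L : E →L[ℝ] E} {v : E} {r : ℝ} {u : Metric.sphere (0 : E) 1} :
    u ∈ dualBand L v r ↔
      |inner ℝ (L v) (u : E)| ≤ r * ‖ContinuousLinearMap.adjoint L u‖ := Iff.rfl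

theorem dualBand_one (v : E) (r : ℝ) : dualBand 1 v r = band v r := by
  ext u
  rw [mem_dualBand, mem_band, ← ContinuousLinearMap.star_eq_adjoint, star_one]
  simp

/-- Both sides of the defining inequality scale by the same normalising factor, which is why the
band is measured against the adjoint image. Together with stationarity this makes the masses of dual
bands harmonic along words. -/
theorem sphereMap_preimage_dualBand {A : E →L[ℝ] E} (hA : Function.Injective A) (L : E →L[ℝ] E)
    (v : E) (r : ℝ) :
    sphereMap _ (adjoint_injective hA) ⁻¹' dualBand L v r = dualBand (A * L) v r := by
  ext u
  have h := inv_norm_apply_ne_zero (adjoint_injective hA) u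
  have h0 : 0 < |‖ContinuousLinearMap.adjoint A u‖⁻¹| := abs_pos.2 h
  rw [Set.mem_preimage, mem_dualBand, mem_dualBand, coe_sphereMap, inner_smul_right, map_smul,
    norm_smul, Real.norm_eq_abs, abs_mul, ContinuousLinearMap.adjoint_inner_right,
    ← ContinuousLinearMap.star_eq_adjoint (A * L), star_mul, mul_left_comm r,
    mul_le_mul_iff_right₀ h0]
  rfl

variable [MeasurableSpace E] [BorelSpace E]

theorem measurableSet_dualBand (L : E →L[ℝ] E) (v : E) (r : ℝ) :
    MeasurableSet (dualBand L v r) :=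
  (isClosed_le (by fun_prop) (by fun_prop)).measurableSet

omit [BorelSpace E] in
/-- If neither the hyperplane bands nor the dual band of `v` have large mass, then `L` expands `v`
almost as much as possible. -/
theorem opNorm_le_of_measureReal_dualBand_lt {μ : Measure (Metric.sphere (0 : E) 1)}
    [IsProbabilityMeasure μ] {r : ℝ} (hr : 0 < r)
    (hband : ∀ x : E, ‖x‖ = 1 → μ.real (band x r) ≤ 1 / 8) {L : E →L[ℝ] E} {v : E}
    (h : μ.real (dualBand L v r) < 1 / 2) : ‖L‖ * r ^ 2 ≤ ‖L v‖ := by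
  rw [← le_div_iff₀ (by positivity)]
  refine L.opNorm_le_of_unit_norm (by positivity) fun z hz => ?_
  rcases eq_or_ne (L z) 0 with h0 | h0
  · rw [h0, norm_zero]; positivity
  rw [le_div_iff₀ (by positivity)]
  set e := ‖L z‖⁻¹ • L z with he
  have hz0 : 0 < ‖L z‖ := norm_pos_iff.2 h0
  have he1 : ‖e‖ = 1 := by rw [he, norm_smul, norm_inv, norm_norm, inv_mul_cancel₀ hz0.ne']
  -- The two sets have total mass below `1 / 2 + 1 / 8`. A point `u` outside both gives one factor
  -- `r` between `‖L z‖` and the adjoint image of `u`, and another between that and `‖L v‖`.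
  obtain ⟨u, hu⟩ : ∃ u, u ∉ dualBand L v r ∪ band e r := by
    by_contra! hall
    have h1 : μ.real (dualBand L v r ∪ band e r) = 1 := by
      rw [Set.eq_univ_of_forall hall, probReal_univ]
    have h2 := measureReal_union_le (μ := μ) (dualBand L v r) (band e r)
    linarith [hband e he1]
  rw [Set.mem_union, not_or, mem_dualBand, mem_band, not_le, not_le] at hu
  have hun : ‖(u : E)‖ = 1 := norm_eq_of_mem_sphere u
  have h1 : |inner ℝ (L v) (u : E)| ≤ ‖L v‖ := by
    simpa [hun] using abs_real_inner_le_norm (L v) (u : E)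
  have h2 : r * ‖L z‖ ≤ ‖ContinuousLinearMap.adjoint L u‖ := by
    have h3 : |inner ℝ z (ContinuousLinearMap.adjoint L (u : E))|
        ≤ ‖ContinuousLinearMap.adjoint L u‖ := by
      simpa [hz] using abs_real_inner_le_norm z (ContinuousLinearMap.adjoint L (u : E))
    rw [ContinuousLinearMap.adjoint_inner_right] at h3
    have h4 : inner ℝ (L z) (u : E) = ‖L z‖ * inner ℝ e (u : E) := by
      rw [he, real_inner_smul_left, ← mul_assoc, mul_inv_cancel₀ hz0.ne', one_mul]
    rw [h4, abs_mul, abs_norm] at h3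
    nlinarith [hu.2]
  nlinarith [hu.1]

variable {k : ℕ}

/-- Under strong irreducibility and contraction, the areas of all parallelograms can be made small
compared with the lengths of the images of two given vectors, along words of bounded length. -/
theorem exists_word_area_le [NeZero k] {A : Fin k → E →L[ℝ] E}
    (hA : ∀ i, Function.Injective (A i))
    (hirr : ¬ ∃ F : Finset (Submodule ℝ E), F.Nonempty ∧ (∀ V ∈ F, V ≠ ⊥ ∧ V ≠ ⊤) ∧
      ∀ i, A i '' (⋃ V ∈ F, (V : Set E)) = ⋃ V ∈ F, (V : Set E))
    {s : ℕ → List (Fin k)} {R : E →L[ℝ] E}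
    (hs : Tendsto (fun n => ‖wordProd A (s n)‖⁻¹ • wordProd A (s n)) atTop (𝓝 R))
    (hR0 : R ≠ 0) (hR1 : ∀ v w, area (R v) (R w) = 0) {δ : ℝ} (hδ : 0 < δ) :
    ∃ N : ℕ, ∀ v w : E, ‖v‖ = 1 → ‖w‖ = 1 → ∃ g : List (Fin k), g.length ≤ N ∧ ∃ C : ℝ,
      (∀ a b, area (wordProd A g a) (wordProd A g b) ≤ C * area a b) ∧
      C ≤ δ * (‖wordProd A g v‖ * ‖wordProd A g w‖) := by
  obtain ⟨e, he⟩ : ∃ e, ContinuousLinearMap.adjoint R e ≠ 0 := by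
    by_contra! h
    refine hR0 (ContinuousLinearMap.ext fun v => ?_)
    have : inner ℝ v (ContinuousLinearMap.adjoint R (R v)) = 0 := by rw [h, inner_zero_right]
    rw [ContinuousLinearMap.adjoint_inner_right] at this
    exact inner_self_eq_zero.1 this
  -- The inequality is strict so that, for a fixed word, it persists near `(v, w)`; compactness then
  -- bounds the length of the words.
  have hloc : ∀ v w : E, ‖v‖ = 1 → ‖w‖ = 1 → ∃ g : List (Fin k), ∃ C : ℝ,
      (∀ a b, area (wordProd A g a) (wordProd A g b) ≤ C * area a b) ∧
      C < δ * (‖wordProd A g v‖ * ‖wordProd A g w‖) := by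
    intro v w hv hw
    have hv0 : v ≠ 0 := by rintro rfl; simp at hv
    have hw0 : w ≠ 0 := by rintro rfl; simp at hw
    -- The word `g` moves both vectors out of the kernel of `R`, by moving them off a hyperplane
    -- containing it. Following `g` by an almost rank-one product keeps both images long while areas
    -- collapse.
    obtain ⟨g, hgv, hgw⟩ := exists_wordProd_inner_ne_zero hA hirr hv0 hw0 he
    set G := wordProd A g
    have hne : ∀ z, inner ℝ (G z) (ContinuousLinearMap.adjoint R e) ≠ 0 → 0 < ‖R (G z)‖ := by
      intro z hz
      rw [ContinuousLinearMap.adjoint_inner_right] at hz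
      exact norm_pos_iff.2 fun h => hz (by rw [h, inner_zero_left])
    set B : ℕ → E →L[ℝ] E := fun n => ‖wordProd A (s n)‖⁻¹ • wordProd A (s n) with hB
    have happ : ∀ z, Tendsto (fun n => ‖B n z‖) atTop (𝓝 ‖R z‖) := fun z =>
      ((((ContinuousLinearMap.apply ℝ E z).continuous.tendsto R).comp hs).norm)
    have h1 : Tendsto (fun n => (‖B n‖ + ‖R‖) * ‖B n - R‖ * ‖G‖ ^ 2) atTop (𝓝 0) := by
      have h2 : Tendsto (fun n => ‖B n - R‖) atTop (𝓝 0) := by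
        simpa using (hs.sub_const R).norm
      simpa using ((hs.norm.add_const ‖R‖).mul h2).mul_const (‖G‖ ^ 2)
    have h2 : Tendsto (fun n => δ * (‖B n (G v)‖ * ‖B n (G w)‖)) atTop
        (𝓝 (δ * (‖R (G v)‖ * ‖R (G w)‖))) := ((happ _).mul (happ _)).const_mul _
    have hpos : 0 < δ * (‖R (G v)‖ * ‖R (G w)‖) := by
      have := hne v hgv
      have := hne w hgw
      positivity
    obtain ⟨n, hn⟩ := (h1.eventually_lt h2 hpos).exists
    set S := wordProd A (s n)
    have hS : ‖S‖ ≠ 0 := by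
      intro h
      have h3 : B n = 0 := by simp only [hB]; rw [h, inv_zero, zero_smul]
      rw [h3] at hn
      simp only [norm_zero, zero_add, zero_sub, norm_neg, zero_apply,
        mul_zero] at hn
      exact absurd hn (not_lt.2 (by positivity))
    have hSB : S = ‖S‖ • B n := by simp only [hB]; rw [smul_smul, mul_inv_cancel₀ hS, one_smul]
    refine ⟨s n ++ g, ‖S‖ ^ 2 * ((‖B n‖ + ‖R‖) * ‖B n - R‖) * ‖G‖ ^ 2, ?_, ?_⟩
    · intro a b
      rw [wordProd_append]
      refine area_comp_le (by positivity) (fun v w => ?_) a b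
      change area (S v) (S w) ≤ _
      rw [hSB, area_smul_map, norm_smul, norm_norm, mul_assoc]
      have hBn : ‖B n‖ = 1 := by
        simp only [hB]; rw [norm_smul, norm_inv, norm_norm, inv_mul_cancel₀ hS]
      have := area_map_le_of_near (B := B n) hR1 v w
      rw [hBn] at this ⊢
      rw [mul_one]
      exact mul_le_mul_of_nonneg_left this (sq_nonneg _)
    · rw [wordProd_append]
      have h3 : ∀ z, ‖(S * G) z‖ = ‖S‖ * ‖B n (G z)‖ := fun z => by
        conv_lhs => rw [hSB]
        simp [norm_smul]
      change _ < δ * (‖(S * G) v‖ * ‖(S * G) w‖)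
      rw [h3, h3]
      have h4 : 0 < ‖S‖ ^ 2 := by positivity
      nlinarith [mul_lt_mul_of_pos_left hn h4]
  have hcpt := ((isCompact_sphere (0 : E) 1).prod (isCompact_sphere (0 : E) 1)).induction_on
    (p := fun t => ∃ N : ℕ, ∀ q ∈ t, ∃ g : List (Fin k), g.length ≤ N ∧ ∃ C : ℝ,
      (∀ a b, area (wordProd A g a) (wordProd A g b) ≤ C * area a b) ∧
      C ≤ δ * (‖wordProd A g q.1‖ * ‖wordProd A g q.2‖)) ⟨0, by simp⟩ ?_ ?_ ?_
  · obtain ⟨N, hN⟩ := hcpt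
    exact ⟨N, fun v w hv hw => hN (v, w) ⟨by simpa using hv, by simpa using hw⟩⟩
  · rintro s t hst ⟨N, hN⟩
    exact ⟨N, fun q hq => hN q (hst hq)⟩
  · rintro s t ⟨N, hN⟩ ⟨N', hN'⟩
    refine ⟨max N N', fun q hq => ?_⟩
    rcases hq with hq | hq
    · obtain ⟨g, hg, h⟩ := hN q hq
      exact ⟨g, hg.trans (le_max_left _ _), h⟩
    · obtain ⟨g, hg, h⟩ := hN' q hq
      exact ⟨g, hg.trans (le_max_right _ _), h⟩
  · rintro ⟨v, w⟩ ⟨hv, hw⟩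
    obtain ⟨g, C, h1, h2⟩ := hloc v w (by simpa using hv) (by simpa using hw)
    refine ⟨{q | C < δ * (‖wordProd A g q.1‖ * ‖wordProd A g q.2‖)},
      mem_nhdsWithin_of_mem_nhds ((isOpen_lt continuous_const (by fun_prop)).mem_nhds h2),
      g.length, fun q hq => ⟨g, le_rfl, C, h1, le_of_lt hq⟩⟩

end Area

/-! ### The projective action -/

section ProjectiveAction

variable {d k : ℕ}

/-- The action of a matrix on Euclidean space, as a continuous linear map. -/
noncomputable def clin (A : GL (Fin d) ℝ) : Euc d →L[ℝ] Euc d :=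
  LinearMap.toContinuousLinearMap (lin A)

theorem clin_apply (A : GL (Fin d) ℝ) (v : Euc d) : clin A v = lin A v := rfl

theorem clin_injective (A : GL (Fin d) ℝ) : Function.Injective (clin A) := lin_injective A

theorem clin_mul (A B : GL (Fin d) ℝ) : clin (A * B) = clin A * clin B := by
  ext v
  simp [clin_apply, lin, Matrix.toLpLin_apply]

theorem clin_one : clin (1 : GL (Fin d) ℝ) = 1 := by
  ext v
  simp [clin_apply, lin]

theorem wordProd_clin (A : Fin k → GL (Fin d) ℝ) (w : List (Fin k)) :
    wordProd (fun i => clin (A i)) w = clin (w.map A).prod := by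
  induction w with
  | nil => simp [clin_one]
  | cons i w ih => simp [ih, clin_mul]

theorem exists_unit_rep (x : Proj d) :
    ∃ (v : Euc d) (hv : v ≠ 0), ‖v‖ = 1 ∧ x = Projectivization.mk ℝ v hv := by
  have h := x.rep_nonzero
  have hn : ‖x.rep‖ ≠ 0 := norm_ne_zero_iff.2 h
  refine ⟨‖x.rep‖⁻¹ • x.rep, smul_ne_zero (inv_ne_zero hn) h, ?_, ?_⟩
  · rw [norm_smul, norm_inv, norm_norm, inv_mul_cancel₀ hn]
  · conv_lhs => rw [← x.mk_rep]
    rw [Projectivization.mk_eq_mk_iff']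
    exact ⟨‖x.rep‖, by rw [smul_smul, mul_inv_cancel₀ hn, one_smul]⟩

theorem clin_ne_zero (A : GL (Fin d) ℝ) {v : Euc d} (hv : v ≠ 0) : clin A v ≠ 0 :=
  (map_ne_zero_iff _ (clin_injective A)).2 hv

theorem act_mk (A : GL (Fin d) ℝ) {v : Euc d} (hv : v ≠ 0) :
    act A (Projectivization.mk ℝ v hv) = Projectivization.mk ℝ (clin A v) (clin_ne_zero A hv) :=
  Projectivization.map_mk _ _ _ _

/-- The metric is the sine of the angle, so projective distortion is a comparison of areas with
lengths. -/
theorem dProj_mk_eq_area {v w : Euc d} (hv : v ≠ 0) (hw : w ≠ 0) :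
    dProj (Projectivization.mk ℝ v hv) (Projectivization.mk ℝ w hw)
      = area v w / (‖v‖ * ‖w‖) := by
  have hv0 : ‖v‖ ≠ 0 := norm_ne_zero_iff.2 hv
  have hw0 : ‖w‖ ≠ 0 := norm_ne_zero_iff.2 hw
  rw [dProj_mk, area, eq_div_iff (by positivity),
    ← Real.sqrt_sq (by positivity : 0 ≤ ‖v‖ * ‖w‖), ← Real.sqrt_mul' _ (by positivity)]
  congr 1
  rw [Real.sqrt_sq (by positivity)]
  field_simp

theorem dProj_act_mk (A : GL (Fin d) ℝ) {v w : Euc d} (hv : v ≠ 0) (hw : w ≠ 0) :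
    dProj (act A (Projectivization.mk ℝ v hv)) (act A (Projectivization.mk ℝ w hw))
      = area (clin A v) (clin A w) / (‖clin A v‖ * ‖clin A w‖) := by
  rw [act_mk, act_mk, dProj_mk_eq_area]

theorem dProj_act_le {A : GL (Fin d) ℝ} {v w : Euc d} (hv : v ≠ 0) (hw : w ≠ 0) (hv1 : ‖v‖ = 1)
    (hw1 : ‖w‖ = 1) {C c : ℝ} (hC : ∀ a b, area (clin A a) (clin A b) ≤ C * area a b)
    (hc : C ≤ c * (‖clin A v‖ * ‖clin A w‖)) :
    dProj (act A (Projectivization.mk ℝ v hv)) (act A (Projectivization.mk ℝ w hw))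
      ≤ c * dProj (Projectivization.mk ℝ v hv) (Projectivization.mk ℝ w hw) := by
  have h1 : 0 < ‖clin A v‖ := norm_pos_iff.2 (clin_ne_zero A hv)
  have h2 : 0 < ‖clin A w‖ := norm_pos_iff.2 (clin_ne_zero A hw)
  rw [dProj_act_mk, dProj_mk_eq_area, hv1, hw1, mul_one, div_one, div_le_iff₀ (by positivity)]
  calc _ ≤ C * area v w := hC _ _
    _ ≤ c * (‖clin A v‖ * ‖clin A w‖) * area v w :=
      mul_le_mul_of_nonneg_right hc (area_nonneg _ _)
    _ = _ := by ring

theorem dProj_nonneg (x y : Proj d) : 0 ≤ dProj x y := Real.sqrt_nonneg _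

theorem dProj_le_one (x y : Proj d) : dProj x y ≤ 1 := by
  refine Real.sqrt_le_iff.2 ⟨zero_le_one, ?_⟩
  linarith [sq_nonneg (inner ℝ x.rep y.rep / (‖x.rep‖ * ‖y.rep‖))]

theorem dProj_self (x : Proj d) : dProj x x = 0 := by
  have h : ‖x.rep‖ ≠ 0 := norm_ne_zero_iff.2 x.rep_nonzero
  rw [dProj, real_inner_self_eq_norm_mul_norm, div_self (mul_ne_zero h h)]
  simp

/-- The diagonal action on pairs of points of projective space. -/
noncomputable def pairAct (A : Fin k → GL (Fin d) ℝ) (i : Fin k) (q : Proj d × Proj d) : Proj d × Proj d :=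
  (act (A i) q.1, act (A i) q.2)

theorem act_one (x : Proj d) : act 1 x = x := by
  obtain ⟨v, hv, -, rfl⟩ := exists_unit_rep x
  rw [act_mk]
  simp only [clin_one, one_apply_eq_self]

theorem act_mul (A B : GL (Fin d) ℝ) (x : Proj d) : act (A * B) x = act A (act B x) := by
  obtain ⟨v, hv, -, rfl⟩ := exists_unit_rep x
  rw [act_mk, act_mk, act_mk]
  simp only [clin_mul]
  rfl

theorem wordMap_pairAct (A : Fin k → GL (Fin d) ℝ) (w : List (Fin k)) (q : Proj d × Proj d) :
    wordMap (pairAct A) w q = (act (w.map A).prod q.1, act (w.map A).prod q.2) := by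
  induction w with
  | nil => simp [act_one]
  | cons i w ih => rw [wordMap_cons, ih, pairAct, List.map_cons, List.prod_cons, act_mul, act_mul]

/-- Equality of a union with its image passes from generators to products, so generators suffice. -/
theorem StronglyIrreducible.not_exists_finset {A : Fin k → GL (Fin d) ℝ}
    (h : StronglyIrreducible (Set.range A)) :
    ¬ ∃ F : Finset (Submodule ℝ (Euc d)), F.Nonempty ∧ (∀ V ∈ F, V ≠ ⊥ ∧ V ≠ ⊤) ∧
      ∀ i, clin (A i) '' (⋃ V ∈ F, (V : Set (Euc d))) = ⋃ V ∈ F, (V : Set (Euc d)) := by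
  rintro ⟨F, hF, hF', hinv⟩
  refine h ⟨F, hF, hF', fun B hB => ?_⟩
  change clin B '' _ = _
  induction hB using Submonoid.closure_induction with
  | mem B hB => obtain ⟨i, rfl⟩ := hB; exact hinv i
  | one => rw [clin_one]; exact Set.image_id _
  | mul B B' _ _ h h' =>
    rw [clin_mul]
    change (fun v => clin B (clin B' v)) '' _ = _
    rw [← Set.image_image (clin B) (clin B'), h', h]

theorem area_smul_smul_self (a b : ℝ) {E : Type*} [NormedAddCommGroup E] [InnerProductSpace ℝ E]
    (v : E) : area (a • v) (b • v) = 0 := by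
  rw [area, Real.sqrt_eq_zero', norm_smul, norm_smul, real_inner_smul_left, real_inner_smul_right,
    real_inner_self_eq_norm_sq, mul_pow, mul_pow, Real.norm_eq_abs, Real.norm_eq_abs, sq_abs,
    sq_abs]
  exact le_of_eq (by ring)

/-- A rank-one limit has its range in a line, so it is non-zero and annihilates all areas; these two
facts are all that the contraction argument requires. -/
theorem Contracting.exists_words {A : Fin k → GL (Fin d) ℝ} (h : Contracting (Set.range A)) :
    ∃ (s : ℕ → List (Fin k)) (R : Euc d →L[ℝ] Euc d),
      Tendsto (fun n => ‖wordProd (fun i => clin (A i)) (s n)‖⁻¹ •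
        wordProd (fun i => clin (A i)) (s n)) atTop (𝓝 R) ∧ R ≠ 0 ∧
      ∀ v w, area (R v) (R w) = 0 := by
  obtain ⟨B, R, hB, hR, hlim⟩ := h
  have hword : ∀ n, ∃ s : List (Fin k), (s.map A).prod = B n := by
    intro n
    obtain ⟨l, hl, hl'⟩ := Submonoid.exists_list_of_mem_closure (hB n)
    rw [← hl']
    clear hl'
    induction l with
    | nil => exact ⟨[], rfl⟩
    | cons a l ih =>
      obtain ⟨s, hs⟩ := ih fun y hy => hl y (List.mem_cons_of_mem _ hy)
      obtain ⟨i, rfl⟩ := hl a List.mem_cons_self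
      exact ⟨i :: s, by simp [hs]⟩
  choose s hs using hword
  set Λ : Matrix (Fin d) (Fin d) ℝ →ₗ[ℝ] (Euc d →L[ℝ] Euc d) :=
    (LinearMap.toContinuousLinearMap (𝕜 := ℝ) (E := Euc d) (F' := Euc d)).toLinearMap ∘ₗ
      Matrix.toEuclideanLin.toLinearMap with hΛ
  have hΛc : Continuous Λ := LinearMap.continuous_of_finiteDimensional Λ
  have hΛA : ∀ C : GL (Fin d) ℝ, Λ C = clin C := fun C => rfl
  have hrange : Module.finrank ℝ (LinearMap.range (Matrix.toEuclideanLin R)) = 1 := by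
    rw [Matrix.toEuclideanLin_eq_toLin_orthonormal, ← Matrix.rank_eq_finrank_range_toLin, hR]
  obtain ⟨r, hr0, hr⟩ := finrank_eq_one_iff'.1 hrange
  have hr' : ∀ v, ∃ c : ℝ, Λ R v = c • (r : Euc d) := fun v => by
    obtain ⟨c, hc⟩ := hr ⟨Matrix.toEuclideanLin R v, LinearMap.mem_range_self _ v⟩
    exact ⟨c, (congrArg Subtype.val hc).symm⟩
  refine ⟨s, Λ R, ?_, ?_, ?_⟩
  · simp only [wordProd_clin, hs]
    have h1 := (hΛc.tendsto R).comp hlim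
    refine h1.congr fun n => ?_
    simp only [Function.comp_apply, map_smul, hΛA]
    rfl
  · intro h0
    obtain ⟨v, hv⟩ := r.2
    have h1 : Λ R v = r := hv
    rw [h0] at h1
    exact hr0 (Subtype.ext h1.symm)
  · intro v w
    obtain ⟨a, ha⟩ := hr' v
    obtain ⟨b, hb⟩ := hr' w
    rw [ha, hb, area_smul_smul_self]

theorem one_le_opNorm_inv_mul (A : GL (Fin d) ℝ) {v : Euc d} (hv : ‖v‖ = 1) :
    1 ≤ ‖clin A⁻¹‖ * ‖clin A v‖ := by
  have h : clin A⁻¹ (clin A v) = v := by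
    change (clin A⁻¹ * clin A) v = v
    rw [← clin_mul, inv_mul_cancel, clin_one]
    rfl
  calc (1 : ℝ) = ‖clin A⁻¹ (clin A v)‖ := by rw [h, hv]
    _ ≤ _ := (clin A⁻¹).le_opNorm _

/-- The projective action of a finite family of matrices is Lipschitz. -/
theorem exists_dProj_pairAct_le (A : Fin k → GL (Fin d) ℝ) :
    ∃ c : ℝ, 1 ≤ c ∧ ∀ i x y, dProj (act (A i) x) (act (A i) y) ≤ c * dProj x y := by
  set f : Fin k → ℝ := fun i => ‖clin (A i)‖ ^ 2 * ‖clin (A i)⁻¹‖ ^ 2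
  have hf : ∀ i, 0 ≤ f i := fun i => by positivity
  refine ⟨1 + ∑ i, f i, by linarith [Finset.sum_nonneg fun i (_ : i ∈ Finset.univ) => hf i],
    fun i x y => ?_⟩
  have hi : f i ≤ 1 + ∑ i, f i := by
    linarith [Finset.single_le_sum (fun i _ => hf i) (Finset.mem_univ i)]
  obtain ⟨v, hv, hv1, rfl⟩ := exists_unit_rep x
  obtain ⟨w, hw, hw1, rfl⟩ := exists_unit_rep y
  refine dProj_act_le hv hw hv1 hw1 (area_map_le_opNorm_sq _) ?_
  have h1 := one_le_opNorm_inv_mul (A i) hv1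
  have h2 := one_le_opNorm_inv_mul (A i) hw1
  calc ‖clin (A i)‖ ^ 2 = ‖clin (A i)‖ ^ 2 * (1 * 1) := by ring
    _ ≤ ‖clin (A i)‖ ^ 2 * ((‖clin (A i)⁻¹‖ * ‖clin (A i) v‖) *
        (‖clin (A i)⁻¹‖ * ‖clin (A i) w‖)) := by gcongr
    _ = f i * (‖clin (A i) v‖ * ‖clin (A i) w‖) := by ring
    _ ≤ _ := by gcongr

/-- Contraction on average for random matrix products driven by a Markov chain. -/
theorem exists_contracted_dProj [NeZero k] {P : Fin k → Fin k → ℝ} (hP : ∀ i j, 0 < P i j)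
    (hP1 : ∀ j, ∑ i, P i j = 1) {A : Fin k → GL (Fin d) ℝ}
    (hirr : StronglyIrreducible (Set.range A)) (hcon : Contracting (Set.range A)) :
    ∃ β K ρ : ℝ, 0 < β ∧ β ≤ 1 ∧ 0 < ρ ∧ ρ < 1 ∧ ∃ F : Fin k → Proj d × Proj d → ℝ,
      ∀ j q, dProj q.1 q.2 ^ β ≤ F j q ∧ F j q ≤ K * dProj q.1 q.2 ^ β ∧
        avgOp P (pairAct A) F j q ≤ ρ * F j q := by
  have hirr' := hirr.not_exists_finset
  have hA : ∀ i, Function.Injective (clin (A i)) := fun i => clin_injective _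
  obtain ⟨s, R, hs, hR0, hR1⟩ := hcon.exists_words
  have hd : Nonempty (Metric.sphere (0 : Euc d) 1) := by
    obtain ⟨v, hv⟩ : ∃ v, R v ≠ 0 := by
      by_contra! h
      exact hR0 (ContinuousLinearMap.ext h)
    have hv0 : v ≠ 0 := by rintro rfl; simp at hv
    exact ⟨⟨‖v‖⁻¹ • v, by simp [norm_smul, hv0]⟩⟩
  obtain ⟨ν, hν, hstat, -⟩ := exists_stationary (fun i j => (hP i j).le) hP1
    (fun i => continuous_sphereMap _ (adjoint_injective (hA i))) hd.some
  obtain ⟨r, hr, hr1, hband⟩ := exists_forall_measureReal_abs_inner_le hν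
    (fun j V hV => measureReal_sphereInter_eq_zero hP hP1 hA hirr' hν hstat V hV j)
    (by norm_num : (0 : ℝ) < 1 / 8)
  obtain ⟨c, hc, hcA⟩ := exists_dProj_pairAct_le A
  obtain ⟨p, hp, hpP⟩ : ∃ p : ℝ, 0 < p ∧ ∀ i j, p ≤ P i j := by
    obtain ⟨⟨i, j⟩, h⟩ := Finite.exists_min fun q : Fin k × Fin k => P q.1 q.2
    exact ⟨P i j, hP i j, fun i' j' => h (i', j')⟩
  -- The level `1 / r ^ 4` comes from a factor `r ^ 2` lost in the expansion of each of the two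
  -- vectors.
  refine exists_contracted (D := fun q : Proj d × Proj d => dProj q.1 q.2) (c := c)
    (l := 1 / r ^ 4) (fun q => dProj_nonneg _ _) hc
    ((one_le_div (by positivity)).2 (pow_le_one₀ hr.le hr1)) hp hpP hP1
    (fun i q => hcA i q.1 q.2) ?_ ?_
  · rintro ⟨x, y⟩
    obtain ⟨v, hv, hv1, rfl⟩ := exists_unit_rep x
    obtain ⟨w, hw, hw1, rfl⟩ := exists_unit_rep y
    set W := wordProd (fun i => clin (A i))
    -- With bands of mass at most `1 / 8`, the factor 2 makes the initial value at most `1 / 2`, and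
    -- a value below 1 forces both dual bands below the threshold `1 / 2`.
    refine ⟨fun j g => 2 * ((ν j).real (dualBand (W g) v r) + (ν j).real (dualBand (W g) w r)),
      fun j g => by positivity, fun j g => ?_, fun j => ?_, fun j g hg => ?_⟩
    · simp only
      rw [hstat j _ (measurableSet_dualBand _ _ _), hstat j _ (measurableSet_dualBand _ _ _)]
      simp only [sphereMap_preimage_dualBand (hA _)]
      rw [← Finset.sum_add_distrib, Finset.mul_sum]
      refine Finset.sum_congr rfl fun i _ => ?_
      simp only [W, wordProd_cons]
      ring
    · simp only [W, wordProd_nil, dualBand_one]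
      linarith [hband v hv1 j, hband w hw1 j]
    · by_contra! hlt
      have h1 : ‖W g‖ * r ^ 2 ≤ ‖W g v‖ :=
        opNorm_le_of_measureReal_dualBand_lt hr (fun x hx => hband x hx j)
          (by linarith [measureReal_nonneg (μ := ν j) (s := dualBand (W g) w r)])
      have h2 : ‖W g‖ * r ^ 2 ≤ ‖W g w‖ :=
        opNorm_le_of_measureReal_dualBand_lt hr (fun x hx => hband x hx j)
          (by linarith [measureReal_nonneg (μ := ν j) (s := dualBand (W g) v r)])
      refine absurd hg (not_lt.2 ?_)
      rw [wordMap_pairAct]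
      simp only [W, wordProd_clin] at h1 h2
      refine dProj_act_le hv hw hv1 hw1 (area_map_le_opNorm_sq _) ?_
      rw [one_div, ← div_eq_inv_mul, le_div_iff₀ (by positivity)]
      calc _ = (‖clin (g.map A).prod‖ * r ^ 2) * (‖clin (g.map A).prod‖ * r ^ 2) := by ring
        _ ≤ _ := by gcongr
  · intro δ hδ
    obtain ⟨N, hN⟩ := exists_word_area_le hA hirr' hs hR0 hR1 hδ
    refine ⟨N, fun ⟨x, y⟩ => ?_⟩
    obtain ⟨v, hv, hv1, rfl⟩ := exists_unit_rep x
    obtain ⟨w, hw, hw1, rfl⟩ := exists_unit_rep y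
    obtain ⟨g, hg, C, hC, hCδ⟩ := hN v w hv1 hw1
    rw [wordProd_clin] at hC hCδ
    refine ⟨g, hg, ?_⟩
    rw [wordMap_pairAct]
    exact dProj_act_le hv hw hv1 hw1 hC hCδ

end ProjectiveAction

/-! ### The transfer operators -/

section TransferOperator

variable {d k : ℕ}

theorem eq_of_dProj_eq_zero {x y : Proj d} (h : dProj x y = 0) : x = y := by
  obtain ⟨v, hv, hv1, rfl⟩ := exists_unit_rep x
  obtain ⟨w, hw, hw1, rfl⟩ := exists_unit_rep y
  rw [dProj_mk_eq_area, hv1, hw1, mul_one, div_one, area_eq_norm_mul_norm hv, hv1, one_mul,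
    norm_eq_zero, sub_eq_zero] at h
  exact ((Projectivization.mk_eq_mk_iff' _ _ _ _ _).2 ⟨_, h.symm⟩).symm

theorem dProj_comm (x y : Proj d) : dProj x y = dProj y x := by
  rw [dProj, dProj, real_inner_comm, mul_comm ‖y.rep‖]

/-- With the signs chosen this way, `‖v - w‖` is bounded by a multiple of the projective distance;
for nearly opposite representatives it would not be. -/
theorem exists_unit_reps_inner_nonneg (x y : Proj d) :
    ∃ (v w : Euc d) (hv : v ≠ 0) (hw : w ≠ 0), ‖v‖ = 1 ∧ ‖w‖ = 1 ∧ 0 ≤ inner ℝ v w ∧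
      x = Projectivization.mk ℝ v hv ∧ y = Projectivization.mk ℝ w hw := by
  obtain ⟨v, hv, hv1, rfl⟩ := exists_unit_rep x
  obtain ⟨w, hw, hw1, rfl⟩ := exists_unit_rep y
  rcases le_total 0 (inner ℝ v w) with h | h
  · exact ⟨v, w, hv, hw, hv1, hw1, h, rfl, rfl⟩
  · refine ⟨v, -w, hv, neg_ne_zero.2 hw, hv1, by rwa [norm_neg], ?_, rfl, ?_⟩
    · rw [inner_neg_right]; linarith
    · rw [Projectivization.mk_eq_mk_iff']
      exact ⟨-1, by simp⟩

theorem log_stretch_sub_le (A : GL (Fin d) ℝ) (x y : Proj d) :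
    Real.log (stretch A x) - Real.log (stretch A y)
      ≤ 2 * ‖clin A⁻¹‖ * ‖clin A‖ * dProj x y := by
  obtain ⟨v, w, hv, hw, hv1, hw1, hvw, rfl, rfl⟩ := exists_unit_reps_inner_nonneg x y
  rw [stretch_mk, stretch_mk, dProj_mk_eq_area, hv1, hw1, mul_one, div_one, div_one, div_one]
  change Real.log ‖clin A v‖ - Real.log ‖clin A w‖ ≤ _
  have h1 : 0 < ‖clin A v‖ := norm_pos_iff.2 (clin_ne_zero A hv)
  have h2 : 0 < ‖clin A w‖ := norm_pos_iff.2 (clin_ne_zero A hw)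
  -- For `c = inner ℝ v w` in `[0, 1]`, this is `2 - 2 * c ≤ 4 * (1 - c ^ 2)`.
  have h3 : ‖v - w‖ ≤ 2 * area v w := by
    have h4 : inner ℝ v w ≤ 1 := by simpa [hv1, hw1] using real_inner_le_norm v w
    have h5 : area v w ^ 2 = 1 - inner ℝ v w ^ 2 := by
      rw [area, hv1, hw1, Real.sq_sqrt (by nlinarith)]
      ring
    refine (sq_le_sq₀ (norm_nonneg _) (mul_nonneg zero_le_two (area_nonneg _ _))).1 ?_
    rw [mul_pow, h5, norm_sub_sq_real, hv1, hw1]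
    nlinarith
  have h4 : ‖clin A v‖ - ‖clin A w‖ ≤ ‖clin A‖ * (2 * area v w) := by
    refine (norm_sub_norm_le _ _).trans ?_
    rw [← map_sub]
    exact ((clin A).le_opNorm _).trans (by gcongr)
  have h5 := one_le_opNorm_inv_mul A hw1
  rw [← Real.log_div h1.ne' h2.ne']
  refine (Real.log_le_sub_one_of_pos (by positivity)).trans ?_
  rw [div_sub_one h2.ne', div_le_iff₀ h2]
  have h6 : 0 ≤ ‖clin A‖ * (2 * area v w) := by have := area_nonneg v w; positivity
  calc _ ≤ (‖clin A‖ * (2 * area v w)) * 1 := by rw [mul_one]; exact h4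
    _ ≤ (‖clin A‖ * (2 * area v w)) * (‖clin A⁻¹‖ * ‖clin A w‖) := by gcongr
    _ = _ := by ring

theorem exists_abs_log_stretch_sub_le (A : Fin k → GL (Fin d) ℝ) :
    ∃ c : ℝ, 0 ≤ c ∧ ∀ i x y,
      |Real.log (stretch (A i) x) - Real.log (stretch (A i) y)| ≤ c * dProj x y := by
  set f : Fin k → ℝ := fun i => 2 * ‖clin (A i)⁻¹‖ * ‖clin (A i)‖
  have hf : ∀ i, 0 ≤ f i := fun i => by positivity
  refine ⟨∑ i, f i, Finset.sum_nonneg fun i _ => hf i, fun i x y => ?_⟩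
  have h1 : ∀ x y, Real.log (stretch (A i) x) - Real.log (stretch (A i) y)
      ≤ (∑ i, f i) * dProj x y := fun x y =>
    (log_stretch_sub_le (A i) x y).trans (mul_le_mul_of_nonneg_right
      (Finset.single_le_sum (fun i _ => hf i) (Finset.mem_univ i)) (dProj_nonneg x y))
  refine abs_le.2 ⟨?_, h1 x y⟩
  have := h1 y x
  rw [dProj_comm y x] at this
  linarith

theorem norm_exp_mul_ofReal {t : ℂ} (ht : t.re = 0) (a : ℝ) : ‖Complex.exp (t * (a : ℂ))‖ = 1 := by
  rw [Complex.norm_exp]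
  simp [ht]

theorem norm_exp_mul_ofReal_sub_le {t : ℂ} (ht : t.re = 0) (a b : ℝ) :
    ‖Complex.exp (t * (a : ℂ)) - Complex.exp (t * (b : ℂ))‖ ≤ ‖t‖ * |a - b| := by
  have h1 : Complex.exp (t * (a : ℂ)) - Complex.exp (t * (b : ℂ))
      = Complex.exp (t * (b : ℂ)) * (Complex.exp (Complex.I * ((t.im * (a - b) : ℝ) : ℂ)) - 1) := by
    rw [mul_sub, ← Complex.exp_add, mul_one]
    congr 2
    have : t = Complex.I * (t.im : ℂ) := by
      apply Complex.ext <;> simp [ht]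
    conv_lhs => rw [this]
    conv_rhs => rw [this]
    push_cast
    simp
    ring
  rw [h1, norm_mul, norm_exp_mul_ofReal ht, one_mul]
  refine (Real.norm_exp_I_mul_ofReal_sub_one_le).trans ?_
  rw [Real.norm_eq_abs, abs_mul]
  gcongr
  exact Complex.abs_im_le_norm t

theorem dSeq_self (θ : ℝ) (ω : Seq k) : dSeq θ ω ω = 0 := by simp [dSeq]

theorem dSeq_pos {θ : ℝ} (hθ : 0 < θ) {ω ω' : Seq k} (h : ω ≠ ω') : 0 < dSeq θ ω ω' := by
  rw [dSeq, if_neg h]; positivity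

theorem dSeq_nonneg {θ : ℝ} (hθ : 0 < θ) (ω ω' : Seq k) : 0 ≤ dSeq θ ω ω' := by
  rw [dSeq]; split_ifs <;> positivity

theorem dSeq_le_one {θ : ℝ} (hθ : 0 < θ) (hθ1 : θ < 1) (ω ω' : Seq k) : dSeq θ ω ω' ≤ 1 := by
  rw [dSeq]
  split_ifs
  · exact zero_le_one
  · exact pow_le_one₀ hθ.le hθ1.le

theorem dSeq_eq_one {θ : ℝ} {ω ω' : Seq k} (h : ω 0 ≠ ω' 0) : dSeq θ ω ω' = 1 := by
  have hne : ω ≠ ω' := fun h' => h (by rw [h'])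
  rw [dSeq, if_neg hne]
  have : PiNat.firstDiff ω ω' = 0 := by
    by_contra h0
    exact h (PiNat.apply_eq_of_lt_firstDiff (Nat.pos_of_ne_zero h0))
  rw [this, pow_zero]

theorem dSeq_cons (θ : ℝ) (i : Fin k) (ω ω' : Seq k) :
    dSeq θ (cons i ω) (cons i ω') = θ * dSeq θ ω ω' := by
  by_cases h : ω = ω'
  · rw [h, dSeq_self, dSeq_self, mul_zero]
  have hne : cons i ω ≠ cons i ω' := fun h' => h (congrArg shift h')
  rw [dSeq, dSeq, if_neg hne, if_neg h, ← pow_succ']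
  congr 1
  apply le_antisymm
  · by_contra! hlt
    have h1 : cons i ω (PiNat.firstDiff ω ω' + 1) = cons i ω' (PiNat.firstDiff ω ω' + 1) :=
      PiNat.apply_eq_of_lt_firstDiff hlt
    exact PiNat.apply_firstDiff_ne h h1
  · by_contra! hlt
    have h1 := PiNat.apply_firstDiff_ne hne
    generalize PiNat.firstDiff (cons i ω) (cons i ω') = m at hlt h1
    cases m with
    | zero => exact h1 rfl
    | succ m =>
      have h2 : ω m = ω' m := PiNat.apply_eq_of_lt_firstDiff (by omega)
      exact h1 h2

/-! ### Transition probabilities, norms and iterates -/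

theorem IsMarkovFullShift.transProb_pos {μ : Measure (Seq k)} [IsProbabilityMeasure μ]
    (hμ : IsMarkovFullShift μ) (i j : Fin k) : 0 < transProb μ i j := by
  have hm : MeasurableSet {ω : Seq k | ω 1 = j} :=
    measurableSet_eq_fun (measurable_pi_apply 1) measurable_const
  have h1 := hμ.full {1} fun _ => j
  have h2 := hμ.full {0, 1} fun n => if n = 0 then i else j
  simp only [Finset.mem_singleton, forall_eq] at h1
  simp only [Finset.mem_insert, Finset.mem_singleton, forall_eq_or_imp, forall_eq, if_true,
    one_ne_zero, if_false] at h2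
  rw [transProb, measureReal_def, cond_apply hm]
  refine ENNReal.toReal_pos (mul_ne_zero ?_ ?_) ?_
  · exact ENNReal.inv_ne_zero.2 (measure_ne_top _ _)
  · have h3 : {ω : Seq k | ω 1 = j} ∩ {ω | ω 0 = i} = {ω | ω 0 = i ∧ ω 1 = j} := by
      ext ω; exact and_comm
    rw [h3]
    exact h2.ne'
  · exact ENNReal.mul_ne_top (ENNReal.inv_ne_top.2 h1.ne') (measure_ne_top _ _)

theorem IsMarkovFullShift.sum_transProb {μ : Measure (Seq k)} [IsProbabilityMeasure μ]
    (hμ : IsMarkovFullShift μ) (j : Fin k) : ∑ i, transProb μ i j = 1 := by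
  have h1 := hμ.full {1} fun _ => j
  simp only [Finset.mem_singleton, forall_eq] at h1
  have : IsProbabilityMeasure (μ[|{ω | ω 1 = j}]) := cond_isProbabilityMeasure h1.ne'
  have h2 : ∀ i, transProb μ i j = (μ[|{ω : Seq k | ω 1 = j}]).real ((fun ω => ω 0) ⁻¹' {i}) :=
    fun i => rfl
  simp only [h2]
  rw [sum_measureReal_preimage_singleton (f := fun ω : Seq k => ω 0) Finset.univ fun i _ =>
    measurableSet_eq_fun (measurable_pi_apply 0) measurable_const]
  simp

theorem transferOp_apply {μ : Measure (Seq k)} {M : Seq k → GL (Fin d) ℝ}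
    (hM : ∀ ω ω' : Seq k, ω 0 = ω' 0 → M ω = M ω') (t : ℂ) (w : Seq k × Proj d → ℂ)
    (ω : Seq k) (x : Proj d) :
    transferOp μ M t w (ω, x) = ∑ i, (transProb μ i (ω 0) : ℂ) *
      (Complex.exp (t * (Real.log (stretch (M fun _ => i) x) : ℂ)) *
        w (cons i ω, act (M fun _ => i) x)) := by
  refine Finset.sum_congr rfl fun i _ => ?_
  have h : M (cons i ω) = M fun _ => i := hM _ _ rfl
  simp only [h, condProb, mul_assoc]
  rfl

theorem bddAbove_of_mem_G {θ α : ℝ} (hθ : 0 < θ) (hθ1 : θ < 1) (hα : 0 < α)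
    {w : Seq k × Proj d → ℂ} (hw : w ∈ G k d θ α) : BddAbove (Set.range fun z => ‖w z‖) := by
  obtain ⟨⟨C, hC, h1⟩, C', hC', h2⟩ := hw
  rcases isEmpty_or_nonempty (Seq k × Proj d) with he | ⟨⟨ω₀, x₀⟩⟩
  · rw [Set.range_eq_empty]; exact bddAbove_empty
  refine ⟨C + C' + ‖w (ω₀, x₀)‖, ?_⟩
  rintro _ ⟨⟨ω, x⟩, rfl⟩
  have h3 : ‖w (ω, x) - w (ω₀, x)‖ ≤ C :=
    (h1 x ω ω₀).trans (mul_le_of_le_one_right hC.le (dSeq_le_one hθ hθ1 _ _))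
  have h4 : ‖w (ω₀, x) - w (ω₀, x₀)‖ ≤ C' :=
    (h2 ω₀ x x₀).trans (mul_le_of_le_one_right hC'.le
      (Real.rpow_le_one (dProj_nonneg _ _) (dProj_le_one _ _) hα.le))
  calc ‖w (ω, x)‖ = ‖(w (ω, x) - w (ω₀, x)) + (w (ω₀, x) - w (ω₀, x₀)) + w (ω₀, x₀)‖ := by
        congr 1; ring
    _ ≤ _ := norm_add₃_le
    _ ≤ _ := by gcongr

/-- Boundedness is essential: the real supremum of an unbounded family is 0 by convention. -/
theorem norm_le_supNorm {θ α : ℝ} (hθ : 0 < θ) (hθ1 : θ < 1) (hα : 0 < α)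
    {w : Seq k × Proj d → ℂ} (hw : w ∈ G k d θ α) (z : Seq k × Proj d) : ‖w z‖ ≤ supNorm w :=
  le_ciSup (bddAbove_of_mem_G hθ hθ1 hα hw) z

theorem lipNorm_nonneg {θ α : ℝ} (hθ : 0 < θ) (f : Seq k × Proj d → ℂ) : 0 ≤ lipNorm θ α f := by
  refine Real.sSup_nonneg ?_
  rintro _ ⟨ω, ω', x, y, -, rfl⟩
  have := dSeq_nonneg hθ ω ω'
  have := Real.rpow_nonneg (dProj_nonneg x y) α
  positivity

theorem norm_sub_le_lipNorm {θ α : ℝ} (hθ : 0 < θ) {w : Seq k × Proj d → ℂ} (hw : w ∈ G k d θ α)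
    (ω ω' : Seq k) (x y : Proj d) :
    ‖w (ω, x) - w (ω', y)‖ ≤ lipNorm θ α w * (dProj x y ^ α + dSeq θ ω ω') := by
  have hD : ∀ (ω ω' : Seq k) (x y : Proj d), 0 ≤ dProj x y ^ α + dSeq θ ω ω' := fun ω ω' x y =>
    add_nonneg (Real.rpow_nonneg (dProj_nonneg x y) α) (dSeq_nonneg hθ ω ω')
  by_cases h : ω ≠ ω' ∨ x ≠ y
  · have hpos : 0 < dProj x y ^ α + dSeq θ ω ω' := by
      rcases h with h | h
      · exact add_pos_of_nonneg_of_pos (Real.rpow_nonneg (dProj_nonneg x y) α) (dSeq_pos hθ h)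
      · exact add_pos_of_pos_of_nonneg (Real.rpow_pos_of_pos (lt_of_le_of_ne (dProj_nonneg x y)
          fun h' => h (eq_of_dProj_eq_zero h'.symm)) α) (dSeq_nonneg hθ ω ω')
    rw [← div_le_iff₀ hpos]
    refine le_csSup ?_ ⟨ω, ω', x, y, h, rfl⟩
    obtain ⟨⟨C, hC, h1⟩, C', hC', h2⟩ := hw
    refine ⟨C + C', ?_⟩
    rintro _ ⟨ω, ω', x, y, -, rfl⟩
    refine div_le_of_le_mul₀ (hD _ _ _ _) (by positivity) ?_
    have h3 := h1 x ω ω'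
    have h4 := h2 ω' x y
    calc ‖w (ω, x) - w (ω', y)‖ ≤ ‖w (ω, x) - w (ω', x)‖ + ‖w (ω', x) - w (ω', y)‖ :=
          norm_sub_le_norm_sub_add_norm_sub _ _ _
      _ ≤ C * dSeq θ ω ω' + C' * dProj x y ^ α := add_le_add h3 h4
      _ ≤ _ := by
        have := mul_nonneg hC.le (Real.rpow_nonneg (dProj_nonneg x y) α)
        have := mul_nonneg hC'.le (dSeq_nonneg hθ ω ω')
        linarith
  · push Not at h
    obtain ⟨rfl, rfl⟩ := h
    rw [sub_self, norm_zero]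
    exact mul_nonneg (lipNorm_nonneg hθ w) (hD _ _ _ _)

theorem mem_G_and_lipNorm_le {θ α B : ℝ} (hθ : 0 < θ) (hα : 0 < α) (hB : 0 ≤ B)
    {f : Seq k × Proj d → ℂ}
    (h : ∀ ω ω' x y, ‖f (ω, x) - f (ω', y)‖ ≤ B * (dProj x y ^ α + dSeq θ ω ω')) :
    f ∈ G k d θ α ∧ lipNorm θ α f ≤ B := by
  -- Membership in `G` asks for strictly positive constants, while `B` may vanish.
  refine ⟨⟨⟨B + 1, by positivity, fun x ω ω' => ?_⟩, B + 1, by positivity, fun ω x y => ?_⟩, ?_⟩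
  · refine (h ω ω' x x).trans ?_
    rw [dProj_self, Real.zero_rpow hα.ne', zero_add]
    exact mul_le_mul_of_nonneg_right (by linarith) (dSeq_nonneg hθ ω ω')
  · refine (h ω ω x y).trans ?_
    rw [dSeq_self, add_zero]
    exact mul_le_mul_of_nonneg_right (by linarith) (Real.rpow_nonneg (dProj_nonneg x y) α)
  · refine Real.sSup_le ?_ hB
    rintro _ ⟨ω, ω', x, y, -, rfl⟩
    exact div_le_of_le_mul₀ (add_nonneg (Real.rpow_nonneg (dProj_nonneg x y) α)
      (dSeq_nonneg hθ ω ω')) hB (h ω ω' x y)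

/-- The iterates of the transfer operator are bounded by `s`, and their oscillation on sequences
with the same initial letter is controlled by a contracted function `F`. -/
theorem transferOp_iterate_bound {μ : Measure (Seq k)} {M : Seq k → GL (Fin d) ℝ}
    (hP : ∀ i j, 0 ≤ transProb μ i j) (hP1 : ∀ j, ∑ i, transProb μ i j = 1)
    (hM : ∀ ω ω' : Seq k, ω 0 = ω' 0 → M ω = M ω') {t : ℂ} (ht : t.re = 0)
    {α θ ρ c s l : ℝ} (hρ : 0 ≤ ρ) (hρ1 : ρ < 1) (hc : 0 ≤ c) (hs : 0 ≤ s) (hl : 0 ≤ l)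
    {F : Fin k → Proj d × Proj d → ℝ} (hF : ∀ j q, dProj q.1 q.2 ^ α ≤ F j q)
    (hFρ : ∀ j q, avgOp (transProb μ) (pairAct fun i => M fun _ => i) F j q ≤ ρ * F j q)
    (hexp : ∀ i x y, ‖Complex.exp (t * (Real.log (stretch (M fun _ => i) x) : ℂ)) -
      Complex.exp (t * (Real.log (stretch (M fun _ => i) y) : ℂ))‖ ≤ c * dProj x y ^ α)
    {w : Seq k × Proj d → ℂ} (hws : ∀ z, ‖w z‖ ≤ s)
    (hwl : ∀ ω ω' x y, ‖w (ω, x) - w (ω', y)‖ ≤ l * (dProj x y ^ α + dSeq θ ω ω')) (n : ℕ) :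
    (∀ z, ‖(transferOp μ M t)^[n] w z‖ ≤ s) ∧
    ∀ ω ω' x y, ω 0 = ω' 0 →
      ‖(transferOp μ M t)^[n] w (ω, x) - (transferOp μ M t)^[n] w (ω', y)‖ ≤
        (s * (c / (1 - ρ)) + l * ρ ^ n) * F (ω 0) (x, y) + l * θ ^ n * dSeq θ ω ω' := by
  have hF0 : ∀ j q, 0 ≤ F j q := fun j q =>
    (Real.rpow_nonneg (dProj_nonneg _ _) α).trans (hF j q)
  have h1ρ : 0 < 1 - ρ := by linarith
  induction n with
  | zero =>
    refine ⟨hws, fun ω ω' x y _ => (hwl ω ω' x y).trans ?_⟩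
    have h1 := mul_le_mul_of_nonneg_left (hF (ω 0) (x, y)) hl
    have h2 : 0 ≤ s * (c / (1 - ρ)) * F (ω 0) (x, y) := by have := hF0 (ω 0) (x, y); positivity
    simp only [pow_zero, mul_one]
    linarith
  | succ n ih =>
    obtain ⟨ih1, ih2⟩ := ih
    set u := (transferOp μ M t)^[n] w with hu
    simp only [Function.iterate_succ_apply', ← hu]
    refine ⟨?_, ?_⟩
    · rintro ⟨ω, x⟩
      rw [transferOp_apply hM]
      refine (norm_sum_le _ _).trans ?_
      calc _ ≤ ∑ i, transProb μ i (ω 0) * s := by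
            refine Finset.sum_le_sum fun i _ => ?_
            rw [norm_mul, norm_mul, norm_exp_mul_ofReal ht, one_mul, Complex.norm_real,
              Real.norm_of_nonneg (hP _ _)]
            exact mul_le_mul_of_nonneg_left (ih1 _) (hP _ _)
        _ = s := by rw [← Finset.sum_mul, hP1, one_mul]
    · intro ω ω' x y hω
      -- Equal initial letters give equal transition probabilities, so the two sums are compared
      -- term by term.
      rw [transferOp_apply hM, transferOp_apply hM, ← hω, ← Finset.sum_sub_distrib]
      refine (norm_sum_le _ _).trans ?_
      -- The coefficient `b = s * (c / (1 - ρ))` is the fixed point of `b = s * c + ρ * b`: each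
      -- step adds a phase error `s * c` and contracts the rest by `ρ`.
      set a := s * (c / (1 - ρ)) + l * ρ ^ n with ha
      have ha0 : 0 ≤ a := by positivity
      calc _ ≤ ∑ i, (transProb μ i (ω 0) * (c * dProj x y ^ α * s + l * θ ^ n * (θ * dSeq θ ω ω'))
              + a * (transProb μ i (ω 0) * F i (pairAct (fun i => M fun _ => i) i (x, y)))) := by
            refine Finset.sum_le_sum fun i _ => ?_
            rw [← mul_sub, norm_mul, Complex.norm_real, Real.norm_of_nonneg (hP _ _)]
            have h1 := ih2 (cons i ω) (cons i ω') (act (M fun _ => i) x) (act (M fun _ => i) y) rfl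
            rw [dSeq_cons] at h1
            set e₁ := Complex.exp (t * (Real.log (stretch (M fun _ => i) x) : ℂ))
            set e₂ := Complex.exp (t * (Real.log (stretch (M fun _ => i) y) : ℂ))
            set u₁ := u (cons i ω, act (M fun _ => i) x)
            set u₂ := u (cons i ω', act (M fun _ => i) y)
            have h2 : ‖e₁ * u₁ - e₂ * u₂‖ ≤ c * dProj x y ^ α * s + ‖u₁ - u₂‖ := by
              have h3 : e₁ * u₁ - e₂ * u₂ = (e₁ - e₂) * u₂ + e₁ * (u₁ - u₂) := by ring
              rw [h3]
              refine (norm_add_le _ _).trans ?_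
              rw [norm_mul, norm_mul, norm_exp_mul_ofReal ht, one_mul]
              exact add_le_add_left (mul_le_mul (hexp i x y) (ih1 _) (norm_nonneg _)
                (mul_nonneg hc (Real.rpow_nonneg (dProj_nonneg x y) α))) _
            refine (mul_le_mul_of_nonneg_left (h2.trans (add_le_add_right h1 _)) (hP _ _)).trans
              (le_of_eq ?_)
            change _ = _ + a * (_ * F i (act (M fun _ => i) x, act (M fun _ => i) y))
            simp only [cons]
            ring
        _ = c * dProj x y ^ α * s + l * θ ^ n * (θ * dSeq θ ω ω') +
              a * avgOp (transProb μ) (pairAct fun i => M fun _ => i) F (ω 0) (x, y) := by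
            rw [Finset.sum_add_distrib, ← Finset.sum_mul, hP1, one_mul, ← Finset.mul_sum]
            rfl
        _ ≤ c * F (ω 0) (x, y) * s + l * θ ^ n * (θ * dSeq θ ω ω') +
              a * (ρ * F (ω 0) (x, y)) := by
            gcongr
            · exact hF (ω 0) (x, y)
            · exact hFρ (ω 0) (x, y)
        _ = _ := by
            rw [ha]
            field_simp
            ring

end TransferOperator

end MarkovMatrixProduct

/-! ### The Doeblin–Fortet inequality -/

open MarkovMatrixProduct in
theorem mainTheorem3 {k d : ℕ} (hd : 2 ≤ d)
    (μ : MeasureTheory.Measure (MarkovMatrixProduct.Seq k))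
    [MeasureTheory.IsProbabilityMeasure μ]
    (hμ : MarkovMatrixProduct.IsMarkovFullShift μ)
    (M : MarkovMatrixProduct.Seq k → GL (Fin d) ℝ)
    (hM : ∀ ω ω' : MarkovMatrixProduct.Seq k, ω 0 = ω' 0 → M ω = M ω')
    (hirr : MarkovMatrixProduct.StronglyIrreducible (Set.range M))
    (hcon : MarkovMatrixProduct.Contracting (Set.range M)) :
    ∃ α₀ : ℝ, 0 < α₀ ∧ ∀ α : ℝ, 0 < α → α ≤ α₀ →
      ∀ t : ℂ, t.re = 0 →
        ∃ θ₀ : ℝ, 0 < θ₀ ∧ θ₀ ≤ 1 ∧ ∀ θ : ℝ, 0 < θ → θ < θ₀ →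
          ∃ C δ : ℝ, 0 < C ∧ 0 < δ ∧ δ < 1 ∧ ∃ N : ℕ, ∀ n : ℕ, N ≤ n →
            ∀ w ∈ MarkovMatrixProduct.G k d θ α,
              (MarkovMatrixProduct.transferOp μ M t)^[n] w ∈ MarkovMatrixProduct.G k d θ α ∧
              MarkovMatrixProduct.lipNorm θ α ((MarkovMatrixProduct.transferOp μ M t)^[n] w) ≤
                C * MarkovMatrixProduct.supNorm w +
                  δ ^ n * MarkovMatrixProduct.lipNorm θ α w := by
  obtain ⟨ω₀⟩ := μ.nonempty_of_neZero
  have : NeZero k := ⟨(Fin.pos (ω₀ 0)).ne'⟩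
  set A : Fin k → GL (Fin d) ℝ := fun i => M fun _ => i with hA
  have hrange : Set.range M = Set.range A := by
    ext B
    constructor
    · rintro ⟨ω, rfl⟩
      exact ⟨ω 0, hM _ _ rfl⟩
    · rintro ⟨i, rfl⟩
      exact ⟨_, rfl⟩
  rw [hrange] at hirr hcon
  have hP : ∀ i j, 0 < transProb μ i j := hμ.transProb_pos
  have hP1 : ∀ j, ∑ i, transProb μ i j = 1 := hμ.sum_transProb
  obtain ⟨β, K, ρ, hβ, hβ1, hρ, hρ1, F, hF⟩ := exists_contracted_dProj hP hP1 hirr hcon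
  obtain ⟨L, hL, hLA⟩ := exists_abs_log_stretch_sub_le A
  -- The exponent of the contracted function serves as `α₀`, and every `θ < 1` is admissible.
  refine ⟨β, hβ, fun α hα hαβ t ht => ⟨1, one_pos, le_rfl, fun θ hθ hθ1 => ?_⟩⟩
  set γ := α / β with hγ
  have hγ0 : 0 < γ := by positivity
  have hγ1 : γ ≤ 1 := (div_le_one hβ).2 hαβ
  have hdγ : ∀ x y : Proj d, dProj x y ^ α = (dProj x y ^ β) ^ γ := fun x y => by
    rw [← Real.rpow_mul (dProj_nonneg x y), hγ, mul_div_cancel₀ _ hβ.ne']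
  have hd0 : ∀ x y : Proj d, 0 ≤ dProj x y ^ β := fun x y => Real.rpow_nonneg (dProj_nonneg x y) β
  have hdα : ∀ x y : Proj d, 0 ≤ dProj x y ^ α := fun x y => Real.rpow_nonneg (dProj_nonneg x y) α
  have hF0 : ∀ j q, 0 ≤ F j q := fun j q => (hd0 q.1 q.2).trans (hF j q).1
  set F' : Fin k → Proj d × Proj d → ℝ := fun j q => F j q ^ γ with hF'
  have hF'1 : ∀ j q, dProj q.1 q.2 ^ α ≤ F' j q := fun j q => by
    rw [hdγ]; exact Real.rpow_le_rpow (hd0 _ _) (hF j q).1 hγ0.le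
  have hF'2 : ∀ j q, F' j q ≤ |K| ^ γ * dProj q.1 q.2 ^ α := fun j q => by
    rw [hdγ, ← Real.mul_rpow (abs_nonneg K) (hd0 _ _)]
    -- `|K|` replaces `K`, whose sign is not part of the contraction statement.
    exact Real.rpow_le_rpow (hF0 _ _)
      ((hF j q).2.1.trans (mul_le_mul_of_nonneg_right (le_abs_self K) (hd0 _ _))) hγ0.le
  have hF'3 : ∀ j q, avgOp (transProb μ) (pairAct A) F' j q ≤ ρ ^ γ * F' j q := fun j q => by
    refine (avgOp_rpow_le (fun i j => (hP i j).le) hP1 hF0 hγ0 hγ1 j q).trans ?_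
    rw [hF', ← Real.mul_rpow hρ.le (hF0 _ _)]
    exact Real.rpow_le_rpow (Finset.sum_nonneg fun i _ => mul_nonneg (hP _ _).le (hF0 _ _))
      (hF j q).2.2 hγ0.le
  have hργ : 0 < ρ ^ γ := Real.rpow_pos_of_pos hρ γ
  have hργ1 : ρ ^ γ < 1 := Real.rpow_lt_one hρ.le hρ1 hγ0
  set R := ρ ^ γ
  set K' := |K| ^ γ
  have hK' : 0 ≤ K' := Real.rpow_nonneg (abs_nonneg K) γ
  have hexp : ∀ i x y, ‖Complex.exp (t * (Real.log (stretch (M fun _ => i) x) : ℂ)) -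
      Complex.exp (t * (Real.log (stretch (M fun _ => i) y) : ℂ))‖ ≤
        ‖t‖ * L * dProj x y ^ α := fun i x y => by
    refine (norm_exp_mul_ofReal_sub_le ht _ _).trans ?_
    rw [mul_assoc]
    refine mul_le_mul_of_nonneg_left ((hLA i x y).trans (mul_le_mul_of_nonneg_left ?_ hL))
      (norm_nonneg t)
    -- Since `α ≤ 1` and distances are at most 1, a Lipschitz bound implies an `α`-Hölder bound with
    -- the same constant.
    have := Real.rpow_le_rpow_of_exponent_ge' (dProj_nonneg x y) (dProj_le_one x y) hα.le
      (hαβ.trans hβ1)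
    rwa [Real.rpow_one] at this
  set C₁ := ‖t‖ * L / (1 - R)
  have hC₁ : 0 ≤ C₁ := by have : 0 < 1 - R := by linarith
                          positivity
  set m := max R θ with hm
  have hm0 : 0 < m := lt_max_of_lt_left hργ
  have hm1 : m < 1 := max_lt hργ1 hθ1
  -- The room between `m` and `δ` absorbs the constant `K' + 1` once `n` is large.
  obtain ⟨δ, hmδ, hδ1⟩ := exists_between hm1
  have hδ0 : 0 < δ := hm0.trans hmδ
  have hlim : Tendsto (fun n : ℕ => (K' + 1) * (m / δ) ^ n) atTop (𝓝 0) := by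
    simpa using (tendsto_pow_atTop_nhds_zero_of_lt_one (by positivity)
      ((div_lt_one hδ0).2 hmδ)).const_mul (K' + 1)
  obtain ⟨N, hN⟩ := eventually_atTop.1 (hlim.eventually_le_const one_pos)
  refine ⟨C₁ * K' + 2, δ, by positivity, hδ0, hδ1, N, fun n hn w hw => ?_⟩
  set s := supNorm w
  set l := lipNorm θ α w
  have hs : 0 ≤ s := Real.iSup_nonneg fun z => norm_nonneg _
  have hl : 0 ≤ l := lipNorm_nonneg hθ w
  have hnδ : K' * R ^ n + θ ^ n ≤ δ ^ n := by
    have h1 := hN n hn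
    rw [div_pow, ← mul_div_assoc, div_le_one (by positivity)] at h1
    have h2 : R ^ n ≤ m ^ n := pow_le_pow_left₀ hργ.le (le_max_left _ _) n
    have h3 : θ ^ n ≤ m ^ n := pow_le_pow_left₀ hθ.le (le_max_right _ _) n
    nlinarith
  obtain ⟨hb1, hb2⟩ := transferOp_iterate_bound (fun i j => (hP i j).le) hP1 hM ht hργ.le hργ1
    (by positivity) hs hl hF'1 hF'3 hexp (norm_le_supNorm hθ hθ1 hα hw)
    (norm_sub_le_lipNorm hθ hw) n
  refine mem_G_and_lipNorm_le hθ hα (by positivity) fun ω ω' x y => ?_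
  have hdθ := dSeq_nonneg hθ ω ω'
  have hd := hdα x y
  by_cases hω : ω 0 = ω' 0
  · have h1 : (s * C₁ + l * R ^ n) * F' (ω 0) (x, y)
        ≤ (s * C₁ + l * R ^ n) * (K' * dProj x y ^ α) :=
      mul_le_mul_of_nonneg_left (hF'2 _ _) (by positivity)
    have h2 : l * (K' * R ^ n + θ ^ n) * (dProj x y ^ α + dSeq θ ω ω')
        ≤ l * δ ^ n * (dProj x y ^ α + dSeq θ ω ω') := by gcongr
    have h3 : 0 ≤ l * θ ^ n * dProj x y ^ α := by positivity
    have h4 : 0 ≤ l * (K' * R ^ n) * dSeq θ ω ω' := by positivity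
    have h5 : 0 ≤ s * C₁ * K' * dSeq θ ω ω' := by positivity
    have h6 : 0 ≤ s * dProj x y ^ α := by positivity
    have h7 : 0 ≤ s * dSeq θ ω ω' := by positivity
    have h8 := hb2 ω ω' x y hω
    linarith
  -- Different initial letters are at distance 1, so the trivial bound `2 * s` suffices; this is the
  -- 2 in the constant `C₁ * K' + 2`.
  · rw [dSeq_eq_one hω]
    have h1 : ‖(transferOp μ M t)^[n] w (ω, x) - (transferOp μ M t)^[n] w (ω', y)‖ ≤ s + s :=
      (norm_sub_le _ _).trans (add_le_add (hb1 _) (hb1 _))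
    have h2 : 0 ≤ C₁ * K' * s + δ ^ n * l := by positivity
    have h3 : 0 ≤ ((C₁ * K' + 2) * s + δ ^ n * l) * dProj x y ^ α := by positivity
    linarith
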